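/- Let $n\in\mathbb N$, let $M_n$ be the algebra of $n\times n$ complex matrices, and let $\rho$ be a quasi-order (a reflexive transitive relation) on $\{1,\dots,n\}$. Write $\rho(i)=\{j:(i,j)\in\rho\}$, $\rho^{-1}(i)=\{j:(j,i)\in\rho\}$, and let $$\mathcal A_\rho=\{A\in M_n : A_{ij}\neq 0\Rightarrow (i,j)\in\rho\}$$ be the structural matrix algebra defined by $\rho$. Call a map $\phi:\mathcal A_\rho\to M_n$ (not assumed linear) a preserver if it is injective, continuous, satisfies $\phi(X)\phi(Y)=\phi(Y)\phi(X)$ whenever $X,Y\in\mathcal A_\rho$ commute, and $\phi(X)$ has the same spectrum as $X$ for every $X\in\mathcal A_\rho$. A Jordan embedding is an injective linear map $\phi$ with $\phi(XY+YX)=\phi(X)\phi(Y)+\phi(Y)\phi(X)$ for all $X,Y$. The following two statements are equivalent: (i) For every $(i,j)\in\rho$ with $i\neq j$ one has $\left|(\rho(i)\cup\rho^{-1}(i))\cap(\rho(j)\cup\rho^{-1}(j))\right|\ge 3$. (ii) Every preserver $\phi:\mathcal A_\rho\to M_n$ is a Jordan embedding. Moreover, if (i) holds, then for every preserver $\phi:\mathcal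 A_\rho\to M_n$ there are an invertible $S\in M_n$, an idempotent $P$ in the centre of $\mathcal A_\rho$, and a transitive map $g:\rho\to\mathbb C^\times$ (that is, $g(i,j)g(j,k)=g(i,k)$ for all $(i,j),(j,k)\in\rho$) such that $$\phi(X)=S\left(P\,g^*(X)+(I-P)\,g^*(X)^t\right)S^{-1}\qquad\text{for all }X\in\mathcal A_\rho,$$ where $g^*$ is the algebra automorphism of $\mathcal A_\rho$ given by $g^*(X)_{ij}=g(i,j)X_{ij}$ for $(i,j)\in\rho$. If (i) fails, then there is a preserver $\phi:\mathcal A_\rho\to M_n$ that is not linear. -/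

import Mathlib

namespace SMA

/-- A quasi-order on `Fin n`: a reflexive and transitive relation. -/
structure IsQuasiOrder {n : ℕ} (ρ : Fin n → Fin n → Prop) : Prop where
  refl : ∀ i, ρ i i
  trans : ∀ i j k, ρ i j → ρ j k → ρ i k

/-- The image `ρ(i) = {j : (i, j) ∈ ρ}`. -/
def image {n : ℕ} (ρ : Fin n → Fin n → Prop) (i : Fin n) : Set (Fin n) := {j | ρ i j}

/-- The preimage `ρ⁻¹(i) = {j : (j, i) ∈ ρ}`. -/
def preimage {n : ℕ} (ρ : Fin n → Fin n → Prop) (i : Fin n) : Set (Fin n) := {j | ρ j i}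

/-- The structural matrix algebra `A_ρ`: all complex matrices supported in `ρ`. -/
def structuralMatrixAlgebra {n : ℕ} (ρ : Fin n → Fin n → Prop) (hρ : IsQuasiOrder ρ) :
    Subalgebra ℂ (Matrix (Fin n) (Fin n) ℂ) where
  carrier := {A | ∀ i j, A i j ≠ 0 → ρ i j}
  mul_mem' := by
    intro A B hA hB i j hij
    rw [Matrix.mul_apply] at hij
    obtain ⟨k, -, hk⟩ := Finset.exists_ne_zero_of_sum_ne_zero hij
    exact hρ.trans i k j (hA i k (left_ne_zero_of_mul hk)) (hB k j (right_ne_zero_of_mul hk))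
  add_mem' := by
    intro A B hA hB i j hij
    by_contra h
    have h1 : A i j = 0 := by_contra fun h' => h (hA i j h')
    have h2 : B i j = 0 := by_contra fun h' => h (hB i j h')
    exact hij (by simp [h1, h2])
  algebraMap_mem' := by
    intro c i j hij
    by_cases h : i = j
    · exact h ▸ hρ.refl i
    · exact absurd (by simp [Matrix.algebraMap_matrix_apply, h]) hij

/-- Every pair `(i, j) ∈ ρ` with `i ≠ j` satisfies
`|(ρ(i) ∪ ρ⁻¹(i)) ∩ (ρ(j) ∪ ρ⁻¹(j))| ≥ 3`. -/
def ThreeCommonNeighbours {n : ℕ} (ρ : Fin n → Fin n → Prop) : Prop :=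
  ∀ i j, ρ i j → i ≠ j →
    3 ≤ ((image ρ i ∪ preimage ρ i) ∩ (image ρ j ∪ preimage ρ j)).ncard

/-- Injective continuous maps `φ : A → M_n` preserving commutativity (in one direction) and the
spectrum (as a set of complex numbers). No linearity is assumed. -/
structure IsPreserver {n : ℕ} {A : Subalgebra ℂ (Matrix (Fin n) (Fin n) ℂ)}
    (φ : A → Matrix (Fin n) (Fin n) ℂ) : Prop where
  injective : Function.Injective φ
  continuous : Continuous φ
  commute : ∀ X Y : A, X * Y = Y * X → φ X * φ Y = φ Y * φ X
  spectrum_eq : ∀ X : A, spectrum ℂ (φ X) = spectrum ℂ (X : Matrix (Fin n) (Fin n) ℂ)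

/-- A Jordan embedding of complex algebras: an injective linear map with
`φ(ab + ba) = φ(a)φ(b) + φ(b)φ(a)`. -/
structure IsJordanEmbedding {A B : Type*} [Ring A] [Algebra ℂ A] [Ring B] [Algebra ℂ B]
    (φ : A → B) : Prop where
  linear : IsLinearMap ℂ φ
  injective : Function.Injective φ
  jordan : ∀ a b : A, φ (a * b + b * a) = φ a * φ b + φ b * φ a

/-- A transitive map `g : ρ → ℂ^×`. It is written as a function of all pairs of indices, but only
its values on `ρ` are constrained or used. -/
def IsTransitiveMap {n : ℕ} (ρ : Fin n → Fin n → Prop) (g : Fin n → Fin n → ℂˣ) : Prop :=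
  ∀ i j k, ρ i j → ρ j k → g i j * g j k = g i k

/-- The algebra automorphism `g^*` of `A_ρ` induced by a transitive map `g`, that is, the one with
`g^*(E_ij) = g(i, j) E_ij` for all `(i, j) ∈ ρ`. -/
def inducedAut {n : ℕ} {ρ : Fin n → Fin n → Prop} (hρ : IsQuasiOrder ρ)
    {g : Fin n → Fin n → ℂˣ} (hg : IsTransitiveMap ρ g) :
    structuralMatrixAlgebra ρ hρ ≃ₐ[ℂ] structuralMatrixAlgebra ρ hρ where
  toFun X := ⟨Matrix.of fun i j => (g i j : ℂ) * X.1 i j,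
    fun i j h => X.2 i j (right_ne_zero_of_mul h)⟩
  invFun X := ⟨Matrix.of fun i j => ((g i j)⁻¹ : ℂˣ) * X.1 i j,
    fun i j h => X.2 i j (right_ne_zero_of_mul h)⟩
  left_inv X := by ext i j; simp
  right_inv X := by ext i j; simp
  map_add' X Y := by ext i j; simp [mul_add]
  map_mul' X Y := by
    ext i j
    simp only [MulMemClass.coe_mul, Matrix.mul_apply, Matrix.of_apply, Finset.mul_sum]
    refine Finset.sum_congr rfl fun k _ => ?_
    by_cases h1 : X.1 i k = 0
    · simp [h1]
    by_cases h2 : Y.1 k j = 0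
    · simp [h2]
    rw [← hg i k j (X.2 i k h1) (Y.2 k j h2)]
    push_cast
    ring
  commutes' c := by
    ext i j
    by_cases h : i = j
    · subst h
      have h1 : g i i = 1 := by simpa using hg i i i (hρ.refl i) (hρ.refl i)
      simp [h1]
    · simp [Matrix.algebraMap_matrix_apply, h]

end SMA

namespace SMA

open Matrix Polynomial Filter Topology

/-! A preserver respects polynomial calculus. If `X` has `n` distinct eigenvalues, then the image of
every polynomial in `X` is diagonal in an eigenbasis of `φ X`, and a connectedness argument shows
that its eigenvalues stay in the right order (`PreservesOn.map_conjDiag`). Since such `X` are dense,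
`φ (p(X)) = p(φ X)` for all polynomials `p` (`PreservesOn.map_aeval`). So `φ` is homogeneous and
preserves idempotents and their orthogonality, and after a conjugation it fixes all diagonal
matrices (`PreservesOn.exists_normalized`).

Everything else is read off from rank-one idempotents `x yᵀ`. The image of `E_jj + a E_ij` lives in
the `{i, j}` block. A third index comparable with `i` and `j` forces it, for `a ≠ 0`, to be `E_jj +
b E_ij` or `E_jj + b E_ji`, with the same choice for all edges of a component of `ρ`; a central
diagonal idempotent undoes the transposed choice. On a chain `i, j, k` the functions `b = f(a)`
satisfy `f_ik (t s) = f_ij t * f_jk s` (`Normalized.entry_mul_entry`) and `f(a) / a` has a limit at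
infinity, so they are linear and their slopes form a transitive map. Once this map is divided out,
`φ` fixes all `E_jj + a E_ij`, hence all rank-one idempotents of the algebra
(`Normalized.map_vecMulVec`), hence everything by spectral decomposition and density
(`Normalized.eq_id`).

If instead no third index is comparable with both `i` and `j`, the `{i, j}` block can be altered on
its own. The map `rescale` multiplies `X i j` by a weight and `X j i` by its inverse. The weight
depends only on the direction of `(X i i - X j j, X i j, X j i)`, which is what commuting matrices
share, and it is not constant, which destroys linearity. -/

/-- Maps on all matrices whose restriction to the subalgebra `A` is an injective continuous
commutativity and spectrum preserver. -/
structure PreservesOn {n : ℕ} (A : Subalgebra ℂ (Matrix (Fin n) (Fin n) ℂ))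
    (φ : Matrix (Fin n) (Fin n) ℂ → Matrix (Fin n) (Fin n) ℂ) : Prop where
  inj : Set.InjOn φ A
  cont : ContinuousOn φ A
  comm : ∀ X ∈ A, ∀ Y ∈ A, Commute X Y → Commute (φ X) (φ Y)
  spec : ∀ X ∈ A, spectrum ℂ (φ X) = spectrum ℂ X

/-! ### Polynomial calculus for preservers. -/

section Calculus

variable {n : ℕ}

/-- The conjugate of the diagonal matrix `d` by the invertible matrix `V`. -/
def conjDiag (V : (Matrix (Fin n) (Fin n) ℂ)ˣ) (d : Fin n → ℂ) : Matrix (Fin n) (Fin n) ℂ :=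
  V.val * diagonal d * V⁻¹.val

lemma conjDiag_add (V : (Matrix (Fin n) (Fin n) ℂ)ˣ) (d e : Fin n → ℂ) :
    conjDiag V (d + e) = conjDiag V d + conjDiag V e := by
  have : diagonal (d + e) = diagonal d + diagonal e := (diagonal_add d e).symm
  simp only [conjDiag, this]
  noncomm_ring

lemma conjDiag_mul (V : (Matrix (Fin n) (Fin n) ℂ)ˣ) (d e : Fin n → ℂ) :
    conjDiag V (d * e) = conjDiag V d * conjDiag V e := by
  have : diagonal (d * e) = diagonal d * diagonal e := (diagonal_mul_diagonal d e).symm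
  simp only [conjDiag, this, mul_assoc, Units.inv_mul_cancel_left]

lemma conjDiag_const (V : (Matrix (Fin n) (Fin n) ℂ)ˣ) (c : ℂ) :
    conjDiag V (fun _ => c) = algebraMap ℂ _ c := by
  have : diagonal (fun _ : Fin n => c) = algebraMap ℂ (Matrix (Fin n) (Fin n) ℂ) c := by
    simp [algebraMap_eq_diagonal, Pi.algebraMap_def]
  rw [conjDiag, this, ← Algebra.commutes, mul_assoc]
  simp

lemma aeval_conjDiag (V : (Matrix (Fin n) (Fin n) ℂ)ˣ) (d : Fin n → ℂ) (p : ℂ[X]) :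
    aeval (conjDiag V d) p = conjDiag V (fun i => p.eval (d i)) := by
  induction p using Polynomial.induction_on with
  | C a => simp [conjDiag_const]
  | add p q hp hq =>
    rw [map_add, hp, hq, ← conjDiag_add]
    congr 1
    ext i
    simp
  | monomial k a h =>
    rw [pow_succ, ← mul_assoc, map_mul, h, aeval_X, ← conjDiag_mul]
    congr 1
    ext i
    simp

lemma spectrum_conjDiag (V : (Matrix (Fin n) (Fin n) ℂ)ˣ) (d : Fin n → ℂ) :
    spectrum ℂ (conjDiag V d) = Set.range d := by
  rw [conjDiag, spectrum.units_conjugate, spectrum_diagonal]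

lemma exists_eq_conjDiag (X : Matrix (Fin n) (Fin n) ℂ) (d : Fin n → ℂ)
    (hd : Function.Injective d) (hs : ∀ i, d i ∈ spectrum ℂ X) : ∃ V, X = conjDiag V d := by
  have h1 : ∀ i, ∃ v, Module.End.HasEigenvector (toLin' X) (d i) v := fun i => by
    have h2 : d i ∈ spectrum ℂ (toLin' X) := by rw [spectrum_toLin']; exact hs i
    exact (Module.End.HasEigenvalue.of_mem_spectrum h2).exists_hasEigenvector
  choose v hv using h1
  have hli := Module.End.eigenvectors_linearIndependent' (toLin' X) d hd v hv
  have hu : IsUnit (Matrix.of v)ᵀ := by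
    rw [← linearIndependent_cols_iff_isUnit]
    exact hli
  obtain ⟨V, hV⟩ := hu
  refine ⟨V, ?_⟩
  have h3 : X * V.val = V.val * diagonal d := by
    ext i j
    have := congrFun (hv j).apply_eq_smul i
    simp only [toLin'_apply, Pi.smul_apply, smul_eq_mul] at this
    rw [mul_diagonal, hV]
    simp only [transpose_apply, of_apply]
    rw [mul_comm, ← this]
    rfl
  rw [conjDiag, ← h3, mul_assoc]
  simp

/-- Commuting with `φ (conjDiag V d)` makes the image diagonal in the basis `V'`, and the spectrum
condition puts the values of `μ` on the diagonal. That they appear in the right order follows by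
continuity along a line from `d` to `μ`. -/
lemma PreservesOn.map_conjDiag {A : Subalgebra ℂ (Matrix (Fin n) (Fin n) ℂ)}
    {φ : Matrix (Fin n) (Fin n) ℂ → Matrix (Fin n) (Fin n) ℂ} (hφ : PreservesOn A φ)
    {V V' : (Matrix (Fin n) (Fin n) ℂ)ˣ} {d : Fin n → ℂ} (hd : Function.Injective d)
    (hA : conjDiag V d ∈ A) (h : φ (conjDiag V d) = conjDiag V' d) (μ : Fin n → ℂ) :
    conjDiag V μ ∈ A ∧ φ (conjDiag V μ) = conjDiag V' μ := by
  -- Since `d` is injective, interpolation makes every `conjDiag V ν` a polynomial in `conjDiag V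
  -- d`.
  have hmem : ∀ ν : Fin n → ℂ, conjDiag V ν ∈ A := by
    intro ν
    have h1 := aeval_conjDiag V d (Lagrange.interpolate Finset.univ d ν)
    have h2 : (fun i => (Lagrange.interpolate Finset.univ d ν).eval (d i)) = ν := by
      ext i
      exact Lagrange.eval_interpolate_at_node _ (hd.injOn) (Finset.mem_univ i)
    rw [h2] at h1
    rw [← h1]
    exact aeval_mem_adjoin_singleton ℂ _ |> (Algebra.adjoin_le (by simpa using hA) ·)
  refine ⟨hmem μ, ?_⟩
  -- The parameter is complex so that removing the countably many `t` with coinciding eigenvalues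
  -- leaves a connected set.
  set γ : ℂ → Fin n → ℂ := fun t => d + t • (μ - d) with hγ
  have hγc : Continuous γ := by fun_prop
  set N : ℂ → Matrix (Fin n) (Fin n) ℂ := fun t => V'⁻¹.val * φ (conjDiag V (γ t)) * V'.val with hN
  have hcd : Continuous fun t => conjDiag V (γ t) := by
    unfold conjDiag
    fun_prop
  have hNc : Continuous N := by
    have : Continuous fun t => φ (conjDiag V (γ t)) :=
      hφ.cont.comp_continuous hcd fun t => hmem _
    exact (continuous_const.mul this).mul continuous_const
  have hoff : ∀ t i j, i ≠ j → N t i j = 0 := by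
    intro t i j hij
    have h1 : Commute (φ (conjDiag V d)) (φ (conjDiag V (γ t))) := by
      refine hφ.comm _ hA _ (hmem _) ?_
      rw [Commute, SemiconjBy, ← conjDiag_mul, ← conjDiag_mul, mul_comm]
    rw [h] at h1
    have h2 : diagonal d * N t = N t * diagonal d := by
      have h3 := congrArg (fun Z => V'⁻¹.val * Z * V'.val) h1.eq
      simpa [conjDiag, mul_assoc, hN] using h3
    have h4 := congrFun (congrFun h2 i) j
    rw [diagonal_mul, mul_diagonal] at h4
    have h5 : (d i - d j) * N t i j = 0 := by linear_combination h4
    exact (mul_eq_zero.1 h5).resolve_left (sub_ne_zero.2 (hd.ne hij))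
  have hdiag : ∀ t, N t = diagonal (fun i => N t i i) := by
    intro t
    ext i j
    by_cases hij : i = j
    · subst hij; simp
    · rw [hoff t i j hij, diagonal_apply_ne _ hij]
  have hφN : ∀ t, φ (conjDiag V (γ t)) = conjDiag V' (fun i => N t i i) := by
    intro t
    have h1 : conjDiag V' (fun i => N t i i) = V'.val * N t * V'⁻¹.val := by
      rw [conjDiag, ← hdiag]
    rw [h1]
    simp [hN, mul_assoc]
  have hval : ∀ t i, ∃ j, γ t j = N t i i := by
    intro t i
    have h1 := hφ.spec _ (hmem (γ t))
    rw [hφN, spectrum_conjDiag, spectrum_conjDiag] at h1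
    have : N t i i ∈ Set.range fun i => N t i i := ⟨i, rfl⟩
    rwa [h1] at this
  have hbad : (⋃ i, ⋃ j, {t | i ≠ j ∧ γ t i = γ t j}).Countable := by
    refine Set.countable_iUnion fun i => Set.countable_iUnion fun j => ?_
    refine Set.Subsingleton.countable ?_
    rintro t ⟨hij, ht⟩ s ⟨-, hs⟩
    simp only [hγ, Pi.add_apply, Pi.smul_apply, Pi.sub_apply, smul_eq_mul] at ht hs
    have hne := sub_ne_zero.2 (hd.ne hij)
    have hne2 : μ i - d i - (μ j - d j) ≠ 0 := by
      intro h0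
      apply hne
      linear_combination ht - t * h0
    apply mul_right_cancel₀ hne2
    linear_combination ht - hs
  set U := (⋃ i, ⋃ j, {t | i ≠ j ∧ γ t i = γ t j})ᶜ with hU
  have hUinj : ∀ t ∈ U, ∀ i j, i ≠ j → γ t i ≠ γ t j := by
    intro t ht i j hij heq
    exact ht (Set.mem_iUnion.2 ⟨i, Set.mem_iUnion.2 ⟨j, hij, heq⟩⟩)
  have hUc : IsPreconnected U :=
    (hbad.isConnected_compl_of_one_lt_rank (by simp)).isPreconnected
  have h0U : (0 : ℂ) ∈ U := by
    simp only [hU, Set.mem_compl_iff, Set.mem_iUnion, not_exists]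
    rintro i j ⟨hij, h0⟩
    exact hij (hd (by simpa [hγ] using h0))
  have hU1 : ∀ i, ∀ t ∈ U, N t i i = γ t i := by
    intro i
    -- The Lagrange basis polynomial of the node `γ t i`, evaluated at `N t i i`. As `N t i i` is
    -- one of the nodes, `f` is a continuous indicator of `N t i i = γ t i`, hence constant on `U`.
    set f : ℂ → ℂ := fun t => ∏ j ∈ Finset.univ.erase i, (N t i i - γ t j) / (γ t i - γ t j)
    have hf : ContinuousOn f U := by
      refine continuousOn_finsetProd _ fun j hj => ?_
      refine ContinuousOn.div (by fun_prop) (by fun_prop) fun t ht => ?_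
      exact sub_ne_zero.2 (hUinj t ht i j (Finset.ne_of_mem_erase hj).symm)
    have hf1 : ∀ t ∈ U, N t i i = γ t i → f t = 1 := by
      intro t ht h1
      refine Finset.prod_eq_one fun j hj => ?_
      rw [h1, div_self]
      exact sub_ne_zero.2 (hUinj t ht i j (Finset.ne_of_mem_erase hj).symm)
    have hf0 : ∀ t ∈ U, N t i i ≠ γ t i → f t = 0 := by
      intro t ht h1
      obtain ⟨j, hj⟩ := hval t i
      have hji : j ≠ i := by rintro rfl; exact h1 hj.symm
      refine Finset.prod_eq_zero (i := j) (Finset.mem_erase.2 ⟨hji, Finset.mem_univ _⟩) ?_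
      simp [hj]
    have hmaps : Set.MapsTo f U {0, 1} := by
      intro t ht
      by_cases h1 : N t i i = γ t i
      · simp [hf1 t ht h1]
      · simp [hf0 t ht h1]
    have hstart : N 0 i i = γ 0 i := by
      have h1 := hφN 0
      have hγ0 : γ 0 = d := by simp [hγ]
      have h2 := congrArg (fun Z => (V'⁻¹.val * Z * V'.val) i i) h
      simp only [conjDiag] at h2
      simp [hN, hγ0, conjDiag, mul_assoc] at h2 ⊢
      exact h2
    obtain ⟨y, -, hy⟩ := hUc.eqOn_const_of_mapsTo (Set.toFinite _).isDiscrete hf hmaps ⟨0, by simp⟩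
    intro t ht
    by_contra hne
    have h1 := hy ht
    have h2 := hy h0U
    rw [hf0 t ht hne] at h1
    rw [hf1 0 h0U hstart] at h2
    simp only [Function.const] at h1 h2
    exact zero_ne_one (h1.trans h2.symm)
  -- The endpoint `t = 1` may be a bad parameter, as `μ` can have repeated values; density of the
  -- good ones covers it.
  have hall : ∀ i, N 1 i i = μ i := by
    intro i
    have h1 : (fun t => N t i i) = fun t => γ t i :=
      Continuous.ext_on (hbad.dense_compl ℂ) (by fun_prop) (by fun_prop) (hU1 i)
    have h2 := congrFun h1 1
    simpa [hγ] using h2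
  have h1 := hφN 1
  have hγ1 : γ 1 = μ := by simp [hγ]
  rw [hγ1] at h1
  rw [h1]
  congr 1
  ext i
  exact hall i

/-- Matrices with `n` distinct eigenvalues. -/
def HasSimpleSpectrum (X : Matrix (Fin n) (Fin n) ℂ) : Prop :=
  ∃ d : Fin n → ℂ, Function.Injective d ∧ Set.range d = spectrum ℂ X

lemma hasSimpleSpectrum_of_separable (X : Matrix (Fin n) (Fin n) ℂ) (h : X.charpoly.Separable) :
    HasSimpleSpectrum X := by
  have h1 := nodup_roots h
  have h2 : Multiset.card X.charpoly.roots = n := by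
    rw [← (IsAlgClosed.splits X.charpoly).natDegree_eq_card_roots, charpoly_natDegree_eq_dim]
    simp
  have h3 : X.charpoly.roots.toFinset.card = n := by
    rw [Multiset.toFinset_card_of_nodup h1, h2]
  let e := X.charpoly.roots.toFinset.equivFinOfCardEq h3
  refine ⟨fun i => e.symm i, Subtype.val_injective.comp e.symm.injective, ?_⟩
  have h4 : Set.range (fun i => (e.symm i : ℂ)) = X.charpoly.roots.toFinset := by
    rw [← Function.comp_def, Set.range_comp, e.symm.surjective.range_eq, Set.image_univ,
      Subtype.range_coe_subtype]
    rfl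
  rw [h4]
  ext z
  rw [mem_spectrum_iff_isRoot_charpoly]
  simp [X.charpoly_monic.ne_zero]

/-- On the line from `X` to a diagonal matrix with distinct entries, the discriminant of the
characteristic polynomial is a nonzero polynomial in `t`, so it vanishes only finitely often. -/
lemma subset_closure_hasSimpleSpectrum (A : Subalgebra ℂ (Matrix (Fin n) (Fin n) ℂ))
    (hA : ∀ d, diagonal d ∈ A) :
    (A : Set (Matrix (Fin n) (Fin n) ℂ)) ⊆ closure {X | X ∈ A ∧ HasSimpleSpectrum X} := by
  intro X hX
  set D : Matrix (Fin n) (Fin n) ℂ := diagonal fun i => ((i : ℕ) : ℂ) with hD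
  set M : Matrix (Fin n) (Fin n) ℂ[X] := X.map C + (Polynomial.X : ℂ[X]) • (D - X).map C with hM
  set Y : ℂ → Matrix (Fin n) (Fin n) ℂ := fun t => X + t • (D - X) with hY
  have hMY : ∀ t, M.map (evalRingHom t) = Y t := by
    intro t
    ext i j
    simp [hM, hY]
  -- The degrees `n` and `n - 1` are fixed in advance so that the resultant commutes with evaluation
  -- at `t`.
  set r := resultant M.charpoly (derivative M.charpoly) n (n - 1) with hr
  have hev : ∀ t, r.eval t = resultant (Y t).charpoly (derivative (Y t).charpoly) := by
    intro t
    have h1 := resultant_map_map M.charpoly (derivative M.charpoly) n (n - 1) (evalRingHom t)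
    rw [← derivative_map, ← charpoly_map, hMY] at h1
    have h2 : (Y t).charpoly.natDegree = n := by simp [charpoly_natDegree_eq_dim]
    rw [natDegree_derivative, h2, h1]
    rfl
  have hcop : ∀ t, r.eval t ≠ 0 ↔ (Y t).charpoly.Separable := by
    intro t
    have h1 : (Y t).charpoly ≠ 0 ∨ derivative (Y t).charpoly ≠ 0 :=
      Or.inl (charpoly_monic _).ne_zero
    rw [hev, Ne, resultant_eq_zero_iff, Polynomial.Separable]
    tauto
  have hr0 : r ≠ 0 := by
    intro h0
    have h1 : (Y 1).charpoly.Separable := by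
      have : Y 1 = D := by simp [hY]
      rw [this, hD, charpoly_diagonal, separable_prod_X_sub_C_iff]
      intro i j hij
      exact Fin.ext (Nat.cast_injective hij)
    rw [← hcop, h0] at h1
    simp at h1
  have hYc : Continuous Y := by fun_prop
  have htend : Tendsto Y (𝓝[≠] 0) (𝓝 X) := by
    have h1 := hYc.tendsto 0
    have h2 : Y 0 = X := by simp [hY]
    rw [h2] at h1
    exact h1.mono_left nhdsWithin_le_nhds
  refine mem_closure_of_tendsto htend ?_
  have hfin : ({t | r.eval t = 0} : Set ℂ).Finite := by
    refine (r.roots.toFinset.finite_toSet).subset fun t ht => ?_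
    simpa [hr0] using ht
  have hev2 : ∀ᶠ t in 𝓝[≠] (0 : ℂ), r.eval t ≠ 0 := by
    have := hfin.isClosed
    have h1 := (hfin.subset (Set.sdiff_subset (t := {0}))).isClosed.isOpen_compl.mem_nhds
      (x := 0) (by simp)
    filter_upwards [nhdsWithin_le_nhds h1, self_mem_nhdsWithin] with t ht1 ht2 ht3
    exact ht1 ⟨ht3, ht2⟩
  filter_upwards [hev2] with t ht
  refine ⟨?_, hasSimpleSpectrum_of_separable _ ((hcop t).1 ht)⟩
  exact A.add_mem hX (A.smul_mem (A.sub_mem (hA _) hX) t)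

lemma PreservesOn.exists_conjDiag {A : Subalgebra ℂ (Matrix (Fin n) (Fin n) ℂ)}
    {φ : Matrix (Fin n) (Fin n) ℂ → Matrix (Fin n) (Fin n) ℂ} (hφ : PreservesOn A φ)
    {X : Matrix (Fin n) (Fin n) ℂ} (hX : X ∈ A) (hs : HasSimpleSpectrum X) :
    ∃ V V' d, Function.Injective d ∧ X = conjDiag V d ∧ φ X = conjDiag V' d := by
  obtain ⟨d, hd, hr⟩ := hs
  obtain ⟨V, hV⟩ := exists_eq_conjDiag X d hd fun i => hr ▸ ⟨i, rfl⟩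
  obtain ⟨V', hV'⟩ := exists_eq_conjDiag (φ X) d hd fun i => by
    rw [hφ.spec X hX, ← hr]; exact ⟨i, rfl⟩
  exact ⟨V, V', d, hd, hV, hV'⟩

lemma aeval_mem {A : Subalgebra ℂ (Matrix (Fin n) (Fin n) ℂ)} {X : Matrix (Fin n) (Fin n) ℂ}
    (hX : X ∈ A) (p : ℂ[X]) : aeval X p ∈ A :=
  Algebra.adjoin_le (by simpa using hX) (aeval_mem_adjoin_singleton ℂ X)

lemma PreservesOn.map_aeval {A : Subalgebra ℂ (Matrix (Fin n) (Fin n) ℂ)}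
    {φ : Matrix (Fin n) (Fin n) ℂ → Matrix (Fin n) (Fin n) ℂ} (hφ : PreservesOn A φ)
    (hA : ∀ d, diagonal d ∈ A) {X : Matrix (Fin n) (Fin n) ℂ} (hX : X ∈ A) (p : ℂ[X]) :
    φ (aeval X p) = aeval (φ X) p := by
  have hp : Continuous fun Y : Matrix (Fin n) (Fin n) ℂ => aeval Y p := p.continuous_aeval
  have h1 : Set.EqOn (fun Y => φ (aeval Y p)) (fun Y => aeval (φ Y) p) A := by
    refine Set.EqOn.of_subset_closure (s := {X | X ∈ A ∧ HasSimpleSpectrum X}) ?_ ?_ ?_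
      (fun Y hY => hY.1) (subset_closure_hasSimpleSpectrum A hA)
    · rintro Y ⟨hY, hs⟩
      obtain ⟨V, V', d, hd, h1, h2⟩ := hφ.exists_conjDiag hY hs
      rw [h1] at h2
      have h3 := (hφ.map_conjDiag hd (h1 ▸ hY) h2 (fun i => p.eval (d i))).2
      simp only [h1, h2, aeval_conjDiag]
      exact h3
    · exact hφ.cont.comp hp.continuousOn fun Y hY => aeval_mem hY p
    · exact hp.comp_continuousOn hφ.cont
  exact h1 hX

lemma PreservesOn.map_smul {A : Subalgebra ℂ (Matrix (Fin n) (Fin n) ℂ)}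
    {φ : Matrix (Fin n) (Fin n) ℂ → Matrix (Fin n) (Fin n) ℂ} (hφ : PreservesOn A φ)
    (hA : ∀ d, diagonal d ∈ A) {X : Matrix (Fin n) (Fin n) ℂ} (hX : X ∈ A) (c : ℂ) :
    φ (c • X) = c • φ X := by
  have h := hφ.map_aeval hA hX (C c * Polynomial.X)
  rw [map_mul, map_mul, aeval_C, aeval_C, aeval_X, aeval_X, Algebra.algebraMap_eq_smul_one,
    smul_mul_assoc, smul_mul_assoc, one_mul, one_mul] at h
  exact h

lemma PreservesOn.map_zero {A : Subalgebra ℂ (Matrix (Fin n) (Fin n) ℂ)}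
    {φ : Matrix (Fin n) (Fin n) ℂ → Matrix (Fin n) (Fin n) ℂ} (hφ : PreservesOn A φ)
    (hA : ∀ d, diagonal d ∈ A) : φ 0 = 0 := by
  simpa using hφ.map_smul hA A.zero_mem 0

lemma PreservesOn.map_ne_zero {A : Subalgebra ℂ (Matrix (Fin n) (Fin n) ℂ)}
    {φ : Matrix (Fin n) (Fin n) ℂ → Matrix (Fin n) (Fin n) ℂ} (hφ : PreservesOn A φ)
    (hA : ∀ d, diagonal d ∈ A) {X : Matrix (Fin n) (Fin n) ℂ} (hX : X ∈ A) (h0 : X ≠ 0) :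
    φ X ≠ 0 := by
  rw [← hφ.map_zero hA]
  exact hφ.inj.ne hX A.zero_mem h0

lemma PreservesOn.map_isIdempotentElem {A : Subalgebra ℂ (Matrix (Fin n) (Fin n) ℂ)}
    {φ : Matrix (Fin n) (Fin n) ℂ → Matrix (Fin n) (Fin n) ℂ} (hφ : PreservesOn A φ)
    (hA : ∀ d, diagonal d ∈ A) {X : Matrix (Fin n) (Fin n) ℂ} (hX : X ∈ A)
    (h : IsIdempotentElem X) : IsIdempotentElem (φ X) := by
  have := hφ.map_aeval hA hX (Polynomial.X ^ 2)
  simpa [pow_two, h.eq, IsIdempotentElem, eq_comm] using this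

/-- Both idempotents are polynomials in the single element `P + 2 Q`, so polynomial calculus
transports all relations between them. -/
lemma PreservesOn.map_orthogonal {A : Subalgebra ℂ (Matrix (Fin n) (Fin n) ℂ)}
    {φ : Matrix (Fin n) (Fin n) ℂ → Matrix (Fin n) (Fin n) ℂ} (hφ : PreservesOn A φ)
    (hA : ∀ d, diagonal d ∈ A) {P Q : Matrix (Fin n) (Fin n) ℂ} (hP : P ∈ A) (hQ : Q ∈ A)
    (iP : IsIdempotentElem P) (iQ : IsIdempotentElem Q) (hPQ : P * Q = 0) (hQP : Q * P = 0) :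
    φ P * φ Q = 0 ∧ φ Q * φ P = 0 ∧ φ (P + Q) = φ P + φ Q := by
  set Z := P + (2 : ℂ) • Q with hZ
  have hZA : Z ∈ A := A.add_mem hP (A.smul_mem hQ 2)
  have hZ2 : Z * Z = P + (4 : ℂ) • Q := by
    simp only [hZ, mul_add, add_mul, mul_smul_comm, smul_mul_assoc, hPQ, hQP, iP.eq, iQ.eq,
      smul_zero, add_zero, zero_add, smul_smul]
    norm_num
  -- On the possible eigenvalues `0, 1, 2` of `Z`, `p` is the indicator of `1` and `q` that of `2`.
  set p : ℂ[X] := C 2 * Polynomial.X - Polynomial.X * Polynomial.X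
  set q : ℂ[X] := C (1 / 2) * (Polynomial.X * Polynomial.X - Polynomial.X)
  have hp : aeval Z p = P := by
    simp only [p, map_sub, map_mul, aeval_X, aeval_C, hZ2, Algebra.algebraMap_eq_smul_one,
      smul_mul_assoc, one_mul]
    rw [hZ]
    module
  have hq : aeval Z q = Q := by
    simp only [q, map_sub, map_mul, aeval_X, aeval_C, hZ2, Algebra.algebraMap_eq_smul_one,
      smul_mul_assoc, one_mul]
    rw [hZ]
    module
  have h1 := hφ.map_aeval hA hZA p
  have h2 := hφ.map_aeval hA hZA q
  have h3 := hφ.map_aeval hA hZA (p * q)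
  have h4 := hφ.map_aeval hA hZA (p + q)
  have h5 := hφ.map_aeval hA hZA (q * p)
  rw [map_mul, hp, hq, hPQ, hφ.map_zero hA, map_mul, ← h1, ← h2, hp, hq] at h3
  rw [map_mul, hp, hq, hQP, hφ.map_zero hA, map_mul, ← h1, ← h2, hp, hq] at h5
  rw [map_add, hp, hq, map_add, ← h1, ← h2, hp, hq] at h4
  exact ⟨h3.symm, h5.symm, h4⟩

end Calculus

/-! ### Preservers fixing the diagonal, and the idempotents of an edge. -/

section Normalized

variable {n : ℕ} {ρ : Fin n → Fin n → Prop} {hρ : IsQuasiOrder ρ}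

lemma diagonal_mem (hρ : IsQuasiOrder ρ) (d : Fin n → ℂ) :
    diagonal d ∈ structuralMatrixAlgebra ρ hρ := by
  intro i j h
  by_cases hij : i = j
  · exact hij ▸ hρ.refl i
  · exact absurd (diagonal_apply_ne d hij) h

lemma vecMulVec_mem {x y : Fin n → ℂ} (h : ∀ i j, x i ≠ 0 → y j ≠ 0 → ρ i j) :
    vecMulVec x y ∈ structuralMatrixAlgebra ρ hρ := by
  intro i j hij
  rw [vecMulVec_apply] at hij
  exact h i j (left_ne_zero_of_mul hij) (right_ne_zero_of_mul hij)

lemma isIdempotentElem_vecMulVec {x y : Fin n → ℂ} (h : y ⬝ᵥ x = 1) :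
    IsIdempotentElem (vecMulVec x y) := by
  rw [IsIdempotentElem, vecMulVec_mul_vecMulVec, h, one_smul]

/-- Preservers on a structural matrix algebra that fix every diagonal matrix. -/
structure Normalized (hρ : IsQuasiOrder ρ)
    (φ : Matrix (Fin n) (Fin n) ℂ → Matrix (Fin n) (Fin n) ℂ) : Prop
    extends PreservesOn (structuralMatrixAlgebra ρ hρ) φ where
  diag : ∀ d, φ (diagonal d) = diagonal d

/-- The idempotent `E_jj + a E_ij`. -/
def colIdem (i j : Fin n) (a : ℂ) : Matrix (Fin n) (Fin n) ℂ :=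
  vecMulVec (Pi.single j 1 + Pi.single i a) (Pi.single j 1)

/-- The idempotent `E_ii + a E_ij`. -/
def rowIdem (i j : Fin n) (a : ℂ) : Matrix (Fin n) (Fin n) ℂ :=
  vecMulVec (Pi.single i 1) (Pi.single i 1 + Pi.single j a)

lemma colIdem_apply (i j : Fin n) (a : ℂ) (k l : Fin n) :
    colIdem i j a k l = if l = j then (if k = j then 1 else 0) + (if k = i then a else 0) else 0 := by
  simp [colIdem, vecMulVec_apply, Pi.single_apply]

lemma rowIdem_apply (i j : Fin n) (a : ℂ) (k l : Fin n) :
    rowIdem i j a k l = if k = i then (if l = i then 1 else 0) + (if l = j then a else 0) else 0 := by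
  simp [rowIdem, vecMulVec_apply, Pi.single_apply]

lemma colIdem_mem {i j : Fin n} (h : ρ i j) (a : ℂ) :
    colIdem i j a ∈ structuralMatrixAlgebra ρ hρ := by
  intro k l hkl
  rw [colIdem_apply] at hkl
  have := hρ.refl j
  grind

lemma rowIdem_mem {i j : Fin n} (h : ρ i j) (a : ℂ) :
    rowIdem i j a ∈ structuralMatrixAlgebra ρ hρ := by
  intro k l hkl
  rw [rowIdem_apply] at hkl
  have := hρ.refl i
  grind

lemma dotProduct_single_add_single (x : Fin n → ℂ) (i j : Fin n) (a b : ℂ) :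
    x ⬝ᵥ (Pi.single i a + Pi.single j b) = x i * a + x j * b := by
  rw [dotProduct_add, dotProduct_single, dotProduct_single]

lemma single_add_single_dotProduct (x : Fin n → ℂ) (i j : Fin n) (a b : ℂ) :
    (Pi.single i a + Pi.single j b) ⬝ᵥ x = a * x i + b * x j := by
  rw [add_dotProduct, single_dotProduct, single_dotProduct]

lemma isIdempotentElem_colIdem {i j : Fin n} (h : i ≠ j) (a : ℂ) :
    IsIdempotentElem (colIdem i j a) := by
  apply isIdempotentElem_vecMulVec
  rw [dotProduct_single_add_single]
  simp [h]

lemma isIdempotentElem_rowIdem {i j : Fin n} (h : i ≠ j) (a : ℂ) :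
    IsIdempotentElem (rowIdem i j a) := by
  apply isIdempotentElem_vecMulVec
  rw [single_add_single_dotProduct]
  simp [h.symm]

lemma colIdem_zero (i j : Fin n) : colIdem i j 0 = diagonal (Pi.single j 1) := by
  ext k l
  rw [colIdem_apply, diagonal_apply, Pi.single_apply]
  grind

lemma rowIdem_zero (i j : Fin n) : rowIdem i j 0 = diagonal (Pi.single i 1) := by
  ext k l
  rw [rowIdem_apply, diagonal_apply, Pi.single_apply]
  grind

lemma rowIdem_add_colIdem {i j : Fin n} (h : i ≠ j) (a : ℂ) :
    rowIdem i j a + colIdem i j (-a) = diagonal (Pi.single i 1 + Pi.single j 1) := by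
  ext k l
  rw [Matrix.add_apply, rowIdem_apply, colIdem_apply, diagonal_apply]
  simp only [Pi.add_apply, Pi.single_apply]
  grind

/-- The matrix `A` vanishes outside of the rows and columns with index `i` or `j`. -/
def SupportedOn (i j : Fin n) (A : Matrix (Fin n) (Fin n) ℂ) : Prop :=
  ∀ k l, A k l ≠ 0 → (k = i ∨ k = j) ∧ (l = i ∨ l = j)

namespace Normalized

variable {φ : Matrix (Fin n) (Fin n) ℂ → Matrix (Fin n) (Fin n) ℂ}

lemma map_vecMulVec_orthogonal (hφ : Normalized hρ φ) {x y z w : Fin n → ℂ}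
    (hxy : vecMulVec x y ∈ structuralMatrixAlgebra ρ hρ)
    (hzw : vecMulVec z w ∈ structuralMatrixAlgebra ρ hρ)
    (h1 : y ⬝ᵥ x = 1) (h2 : w ⬝ᵥ z = 1) (h3 : y ⬝ᵥ z = 0) (h4 : w ⬝ᵥ x = 0) :
    φ (vecMulVec x y) * φ (vecMulVec z w) = 0 ∧ φ (vecMulVec z w) * φ (vecMulVec x y) = 0 := by
  have := hφ.map_orthogonal (diagonal_mem hρ) hxy hzw (isIdempotentElem_vecMulVec h1)
    (isIdempotentElem_vecMulVec h2) (by simp [vecMulVec_mul_vecMulVec, h3])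
    (by simp [vecMulVec_mul_vecMulVec, h4])
  exact ⟨this.1, this.2.1⟩

/-- If `φ` maps the rank one idempotent `z wᵀ` orthogonal to `x yᵀ` to `z' w'ᵀ`, then
`φ(x yᵀ) z' = 0` and `w'ᵀ φ(x yᵀ) = 0`. -/
lemma mulVec_eq_zero_of_map_eq (hφ : Normalized hρ φ) {x y z w z' w' : Fin n → ℂ}
    (hxy : vecMulVec x y ∈ structuralMatrixAlgebra ρ hρ)
    (hzw : vecMulVec z w ∈ structuralMatrixAlgebra ρ hρ)
    (h1 : y ⬝ᵥ x = 1) (h2 : w ⬝ᵥ z = 1) (h3 : y ⬝ᵥ z = 0) (h4 : w ⬝ᵥ x = 0)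
    (hmap : φ (vecMulVec z w) = vecMulVec z' w') :
    φ (vecMulVec x y) *ᵥ z' = 0 ∧ w' ᵥ* φ (vecMulVec x y) = 0 := by
  have h := hφ.map_vecMulVec_orthogonal hxy hzw h1 h2 h3 h4
  have h0 : vecMulVec z w ≠ 0 := by
    rw [Ne, vecMulVec_eq_zero]
    rintro (rfl | rfl) <;> simp at h2
  have h0' := hφ.map_ne_zero (diagonal_mem hρ) hzw h0
  rw [hmap, Ne, vecMulVec_eq_zero, not_or] at h0'
  rw [hmap, mul_vecMulVec, vecMulVec_mul] at h
  exact ⟨(vecMulVec_eq_zero.1 h.1).resolve_right h0'.2,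
    (vecMulVec_eq_zero.1 h.2).resolve_left h0'.1⟩

/-- The idempotent `E_kk` is fixed and orthogonal to `x yᵀ`, so it annihilates the image from both
sides. -/
lemma map_vecMulVec_apply_eq_zero (hφ : Normalized hρ φ) {x y : Fin n → ℂ}
    (hxy : vecMulVec x y ∈ structuralMatrixAlgebra ρ hρ)
    (h1 : y ⬝ᵥ x = 1) {k : Fin n} (hx : x k = 0) (hy : y k = 0) (l : Fin n) :
    φ (vecMulVec x y) k l = 0 ∧ φ (vecMulVec x y) l k = 0 := by
  have hd : vecMulVec (Pi.single k 1) (Pi.single k 1) = diagonal (Pi.single k (1 : ℂ)) := by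
    simpa [rowIdem] using rowIdem_zero k k
  have h := hφ.mulVec_eq_zero_of_map_eq hxy (z := Pi.single k 1) (w := Pi.single k 1)
    (by rw [hd]; exact diagonal_mem hρ _) h1 (by simp) (by simp [hy]) (by simp [hx])
    (by rw [hd, hφ.diag])
  have h3 := congrFun h.1 l
  have h4 := congrFun h.2 l
  simp at h3 h4
  exact ⟨h4, h3⟩

lemma map_colIdem_supportedOn (hφ : Normalized hρ φ) {i j : Fin n} (h : ρ i j) (hij : i ≠ j)
    (a : ℂ) : SupportedOn i j (φ (colIdem i j a)) := by
  have h1 : (Pi.single j 1 : Fin n → ℂ) ⬝ᵥ (Pi.single j 1 + Pi.single i a) = 1 := by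
    rw [dotProduct_single_add_single]; simp [hij]
  have key : ∀ k, k ≠ i → k ≠ j → ∀ l, φ (colIdem i j a) k l = 0 ∧ φ (colIdem i j a) l k = 0 := by
    intro k hki hkj l
    exact hφ.map_vecMulVec_apply_eq_zero (colIdem_mem h a) h1
      (by simp [hki, hkj]) (by simp [hkj]) l
  intro k l hkl
  constructor
  · by_contra! hc
    exact hkl (key k hc.1 hc.2 l).1
  · by_contra! hc
    exact hkl (key l hc.1 hc.2 k).2

lemma map_rowIdem (hφ : Normalized hρ φ) {i j : Fin n} (h : ρ i j) (hij : i ≠ j) (a : ℂ) :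
    φ (rowIdem i j a) = diagonal (Pi.single i 1 + Pi.single j 1) - φ (colIdem i j (-a)) := by
  have h1 := (hφ.map_orthogonal (diagonal_mem hρ) (rowIdem_mem h a) (colIdem_mem h (-a))
    (isIdempotentElem_rowIdem hij a) (isIdempotentElem_colIdem hij (-a)) ?_ ?_).2.2
  · rw [rowIdem_add_colIdem hij, hφ.diag] at h1
    rw [h1, add_sub_cancel_right]
  · rw [rowIdem, colIdem, vecMulVec_mul_vecMulVec, single_add_single_dotProduct]
    simp [hij, hij.symm]
  · rw [rowIdem, colIdem, vecMulVec_mul_vecMulVec, dotProduct_single]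
    simp [hij]

lemma map_rowIdem_supportedOn (hφ : Normalized hρ φ) {i j : Fin n} (h : ρ i j) (hij : i ≠ j)
    (a : ℂ) : SupportedOn i j (φ (rowIdem i j a)) := by
  intro k l hkl
  rw [hφ.map_rowIdem h hij, Matrix.sub_apply, diagonal_apply] at hkl
  have := hφ.map_colIdem_supportedOn h hij (-a) k l
  simp only [Pi.add_apply, Pi.single_apply] at hkl
  grind

end Normalized

/-- The idempotents `A` and `B` overlap only in the index `i`; being orthogonal they are
triangular of the same kind. -/
lemma orthogonal_idempotents_overlap {A B : Matrix (Fin n) (Fin n) ℂ} {i j k : Fin n}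
    (hij : i ≠ j) (hik : i ≠ k) (hjk : j ≠ k) (hA : SupportedOn i j A) (hB : SupportedOn i k B)
    (iA : IsIdempotentElem A) (iB : IsIdempotentElem B) (hAB : A * B = 0) (hBA : B * A = 0)
    (hA0 : A ≠ 0) (hB0 : B ≠ 0) (hA1 : A ≠ diagonal (Pi.single j 1))
    (hB1 : B ≠ diagonal (Pi.single k 1)) :
    (A i i = 0 ∧ A j j = 1 ∧ B i i = 0 ∧ B k k = 1) ∧
      ((A j i = 0 ∧ A i j ≠ 0 ∧ B k i = 0 ∧ B i k ≠ 0) ∨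
        (A i j = 0 ∧ A j i ≠ 0 ∧ B i k = 0 ∧ B k i ≠ 0)) := by
  -- The supports share only the index `i`, so a single term of the matrix product survives.
  have eAB : ∀ l m, A l i * B i m = 0 := by
    intro l m
    have h := congrFun (congrFun hAB l) m
    rw [mul_apply, Fintype.sum_eq_single i] at h
    · simpa using h
    · intro s hs
      by_contra h0
      have h1 := (hA l s (left_ne_zero_of_mul h0)).2
      have h2 := (hB s m (right_ne_zero_of_mul h0)).1
      grind
  have eBA : ∀ l m, B l i * A i m = 0 := by
    intro l m
    have h := congrFun (congrFun hBA l) m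
    rw [mul_apply, Fintype.sum_eq_single i] at h
    · simpa using h
    · intro s hs
      by_contra h0
      have h1 := (hB l s (left_ne_zero_of_mul h0)).2
      have h2 := (hA s m (right_ne_zero_of_mul h0)).1
      grind
  have idem : ∀ {C : Matrix (Fin n) (Fin n) ℂ} {s : Fin n}, i ≠ s → SupportedOn i s C →
      IsIdempotentElem C → ∀ l m, C l i * C i m + C l s * C s m = C l m := by
    intro C s his hC iC l m
    have h := congrFun (congrFun iC.eq l) m
    rw [mul_apply, Fintype.sum_eq_add i s his] at h
    · exact h
    · rintro t ⟨h1, h2⟩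
      by_contra h0
      have := (hC l t (left_ne_zero_of_mul h0)).2
      grind
  have last : ∀ {C : Matrix (Fin n) (Fin n) ℂ} {s : Fin n}, i ≠ s → SupportedOn i s C →
      IsIdempotentElem C → C ≠ 0 → C i i = 0 → C s s = 1 := by
    intro C s his hC iC h0 h1
    have e := idem his hC iC
    have e1 := e i i
    have e2 := e i s
    have e3 := e s i
    have e4 := e s s
    by_contra hss
    have h2 : C s s = 0 := by
      have h5 : C i s * C s i = 0 := by rw [h1] at e1; simpa using e1
      have : C s s * (C s s - 1) = 0 := by linear_combination e4 - h5
      exact (mul_eq_zero.1 this).resolve_right (sub_ne_zero.2 hss)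
    have h3 : C i s = 0 := by rw [← e2, h1, h2]; simp
    have h4 : C s i = 0 := by rw [← e3, h1, h2]; simp
    apply h0
    ext l m
    rw [Matrix.zero_apply]
    have := hC l m
    grind
  have shape : ∀ {C : Matrix (Fin n) (Fin n) ℂ} {s : Fin n}, i ≠ s → SupportedOn i s C →
      C i i = 0 → C s s = 1 → C i s = 0 → C s i = 0 → C = diagonal (Pi.single s 1) := by
    intro C s his hC h1 h2 h3 h4
    ext l m
    rw [diagonal_apply, Pi.single_apply]
    have := hC l m
    grind
  -- A nonzero `A i i` kills the row and column `i` of `B`, leaving only `E_kk`, which is excluded.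
  have hBii : A i i ≠ 0 → B = diagonal (Pi.single k 1) := by
    intro h0
    have h1 : ∀ m, B i m = 0 := fun m => (mul_eq_zero.1 (eAB i m)).resolve_left h0
    have h2 : ∀ l, B l i = 0 := fun m => (mul_eq_zero.1 (eBA m i)).resolve_right h0
    exact shape hik hB (h1 i) (last hik hB iB hB0 (h1 i)) (h1 k) (h2 k)
  have hAii : B i i ≠ 0 → A = diagonal (Pi.single j 1) := by
    intro h0
    have h1 : ∀ m, A i m = 0 := fun m => (mul_eq_zero.1 (eBA i m)).resolve_left h0
    have h2 : ∀ l, A l i = 0 := fun m => (mul_eq_zero.1 (eAB m i)).resolve_right h0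
    exact shape hij hA (h1 i) (last hij hA iA hA0 (h1 i)) (h1 j) (h2 j)
  have a0 : A i i = 0 := by by_contra h; exact hB1 (hBii h)
  have b0 : B i i = 0 := by by_contra h; exact hA1 (hAii h)
  have a1 := last hij hA iA hA0 a0
  have b1 := last hik hB iB hB0 b0
  refine ⟨⟨a0, a1, b0, b1⟩, ?_⟩
  have pA := idem hij hA iA i i
  have pB := idem hik hB iB i i
  have sA := fun h1 h2 => hA1 (shape hij hA a0 a1 h1 h2)
  have sB := fun h1 h2 => hB1 (shape hik hB b0 b1 h1 h2)
  -- Now `A i j * A j i`, `B i k * B k i`, `A j i * B i k` and `B k i * A i j` all vanish, while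
  -- neither matrix is diagonal. Hence the two triangular shapes agree.
  have q1 := eAB j k
  have q2 := eBA k j
  simp only [a0, b0, mul_zero, zero_add, mul_eq_zero] at pA pB q1 q2
  grind

end Normalized

/-! ### Plain and flipped edges. -/

section Types

variable {n : ℕ} {ρ : Fin n → Fin n → Prop} {hρ : IsQuasiOrder ρ}

/-- `φ` maps every `E_jj + a E_ij`, `a ≠ 0`, to some `E_jj + b E_ij`, `b ≠ 0` (as far as the rows
and columns `i`, `j` are concerned). -/
def IsPlain (φ : Matrix (Fin n) (Fin n) ℂ → Matrix (Fin n) (Fin n) ℂ) (i j : Fin n) : Prop :=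
  ∀ a ≠ 0, φ (colIdem i j a) i i = 0 ∧ φ (colIdem i j a) j j = 1 ∧
    φ (colIdem i j a) j i = 0 ∧ φ (colIdem i j a) i j ≠ 0

/-- `φ` maps every `E_jj + a E_ij`, `a ≠ 0`, to some `E_jj + b E_ji`, `b ≠ 0` (as far as the rows
and columns `i`, `j` are concerned). -/
def IsFlipped (φ : Matrix (Fin n) (Fin n) ℂ → Matrix (Fin n) (Fin n) ℂ) (i j : Fin n) : Prop :=
  ∀ a ≠ 0, φ (colIdem i j a) i i = 0 ∧ φ (colIdem i j a) j j = 1 ∧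
    φ (colIdem i j a) i j = 0 ∧ φ (colIdem i j a) j i ≠ 0

variable {φ : Matrix (Fin n) (Fin n) ℂ → Matrix (Fin n) (Fin n) ℂ}

lemma IsPlain.not_isFlipped {i j : Fin n} (h : IsPlain φ i j) : ¬ IsFlipped φ i j := fun h' =>
  (h 1 one_ne_zero).2.2.2 (h' 1 one_ne_zero).2.2.1

lemma colIdem_ne_zero (i j : Fin n) (hij : i ≠ j) (a : ℂ) : colIdem i j a ≠ 0 := by
  intro h
  have := congrFun (congrFun h j) j
  simp [colIdem_apply, hij.symm] at this

lemma rowIdem_ne_zero (i j : Fin n) (hij : i ≠ j) (a : ℂ) : rowIdem i j a ≠ 0 := by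
  intro h
  have := congrFun (congrFun h i) i
  simp [rowIdem_apply, hij] at this

lemma colIdem_ne_diagonal {i j : Fin n} (hij : i ≠ j) {a : ℂ} (ha : a ≠ 0) (d : Fin n → ℂ) :
    colIdem i j a ≠ diagonal d := by
  intro h
  have := congrFun (congrFun h i) j
  simp [colIdem_apply, hij, ha] at this

lemma rowIdem_ne_diagonal {i j : Fin n} (hij : i ≠ j) {a : ℂ} (ha : a ≠ 0) (d : Fin n → ℂ) :
    rowIdem i j a ≠ diagonal d := by
  intro h
  have := congrFun (congrFun h i) j
  simp [rowIdem_apply, hij, hij.symm, ha] at this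

lemma Normalized.ne_diagonal (hφ : Normalized hρ φ) {X : Matrix (Fin n) (Fin n) ℂ}
    (hX : X ∈ structuralMatrixAlgebra ρ hρ) {d : Fin n → ℂ} (h : X ≠ diagonal d) :
    φ X ≠ diagonal d := by
  rw [← hφ.diag]
  exact hφ.inj.ne hX (diagonal_mem hρ d) h

/-- The idempotents `E_jj + a E_ij` and `E_kk + b E_ik` are orthogonal and overlap only in the index
`i`, so their images have the same triangular shape. Varying one parameter while the other stays `1`
makes the type independent of `a` and `b`. -/
lemma Normalized.types_of_source (hφ : Normalized hρ φ) {i j k : Fin n} (hij : i ≠ j)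
    (hik : i ≠ k) (hjk : j ≠ k) (h1 : ρ i j) (h2 : ρ i k) :
    (IsPlain φ i j ∧ IsPlain φ i k) ∨ (IsFlipped φ i j ∧ IsFlipped φ i k) := by
  have key := fun (a b : ℂ) (ha : a ≠ 0) (hb : b ≠ 0) => by
    have ho := hφ.map_orthogonal (diagonal_mem hρ) (colIdem_mem h1 a) (colIdem_mem h2 b)
      (isIdempotentElem_colIdem hij a) (isIdempotentElem_colIdem hik b)
      (by rw [colIdem, colIdem, vecMulVec_mul_vecMulVec, dotProduct_single_add_single]
          simp [hij, hjk])
      (by rw [colIdem, colIdem, vecMulVec_mul_vecMulVec, dotProduct_single_add_single]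
          simp [hik, hjk.symm])
    exact orthogonal_idempotents_overlap hij hik hjk
      (hφ.map_colIdem_supportedOn h1 hij a) (hφ.map_colIdem_supportedOn h2 hik b)
      (hφ.map_isIdempotentElem (diagonal_mem hρ) (colIdem_mem h1 a)
        (isIdempotentElem_colIdem hij a))
      (hφ.map_isIdempotentElem (diagonal_mem hρ) (colIdem_mem h2 b)
        (isIdempotentElem_colIdem hik b)) ho.1 ho.2.1
      (hφ.map_ne_zero (diagonal_mem hρ) (colIdem_mem h1 a) (colIdem_ne_zero i j hij a))
      (hφ.map_ne_zero (diagonal_mem hρ) (colIdem_mem h2 b) (colIdem_ne_zero i k hik b))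
      (hφ.ne_diagonal (colIdem_mem h1 a) (colIdem_ne_diagonal hij ha _))
      (hφ.ne_diagonal (colIdem_mem h2 b) (colIdem_ne_diagonal hik hb _))
  have h11 := key 1 1 one_ne_zero one_ne_zero
  rcases h11.2 with h | h
  · left
    constructor
    · intro a ha
      have := key a 1 ha one_ne_zero
      grind
    · intro a ha
      have := key 1 a one_ne_zero ha
      grind
  · right
    constructor
    · intro a ha
      have := key a 1 ha one_ne_zero
      grind
    · intro a ha
      have := key 1 a one_ne_zero ha
      grind

/-- The same argument for the row idempotents of two edges into `k`; `conv` translates the outcome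
back to column idempotents. -/
lemma Normalized.types_of_target (hφ : Normalized hρ φ) {i j k : Fin n} (hij : i ≠ j)
    (hik : i ≠ k) (hjk : j ≠ k) (h1 : ρ i k) (h2 : ρ j k) :
    (IsPlain φ i k ∧ IsPlain φ j k) ∨ (IsFlipped φ i k ∧ IsFlipped φ j k) := by
  have swap : ∀ {s : Fin n} {C : Matrix (Fin n) (Fin n) ℂ}, SupportedOn s k C →
      SupportedOn k s C := fun h l m hlm => by
    have := h l m hlm
    tauto
  have key := fun (a b : ℂ) (ha : a ≠ 0) (hb : b ≠ 0) => by
    have ho := hφ.map_orthogonal (diagonal_mem hρ) (rowIdem_mem h1 a) (rowIdem_mem h2 b)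
      (isIdempotentElem_rowIdem hik a) (isIdempotentElem_rowIdem hjk b)
      (by rw [rowIdem, rowIdem, vecMulVec_mul_vecMulVec, single_add_single_dotProduct]
          simp [hij, hjk.symm])
      (by rw [rowIdem, rowIdem, vecMulVec_mul_vecMulVec, single_add_single_dotProduct]
          simp [hik.symm, hij.symm])
    exact orthogonal_idempotents_overlap hik.symm hjk.symm hij
      (swap (hφ.map_rowIdem_supportedOn h1 hik a)) (swap (hφ.map_rowIdem_supportedOn h2 hjk b))
      (hφ.map_isIdempotentElem (diagonal_mem hρ) (rowIdem_mem h1 a)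
        (isIdempotentElem_rowIdem hik a))
      (hφ.map_isIdempotentElem (diagonal_mem hρ) (rowIdem_mem h2 b)
        (isIdempotentElem_rowIdem hjk b)) ho.1 ho.2.1
      (hφ.map_ne_zero (diagonal_mem hρ) (rowIdem_mem h1 a) (rowIdem_ne_zero i k hik a))
      (hφ.map_ne_zero (diagonal_mem hρ) (rowIdem_mem h2 b) (rowIdem_ne_zero j k hjk b))
      (hφ.ne_diagonal (rowIdem_mem h1 a) (rowIdem_ne_diagonal hik ha _))
      (hφ.ne_diagonal (rowIdem_mem h2 b) (rowIdem_ne_diagonal hjk hb _))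
  have conv : ∀ {s : Fin n}, s ≠ k → ρ s k → ∀ a,
      φ (colIdem s k a) s s = 1 - φ (rowIdem s k (-a)) s s ∧
      φ (colIdem s k a) k k = 1 - φ (rowIdem s k (-a)) k k ∧
      φ (colIdem s k a) s k = - φ (rowIdem s k (-a)) s k ∧
      φ (colIdem s k a) k s = - φ (rowIdem s k (-a)) k s := by
    intro s hsk hs a
    have h := hφ.map_rowIdem hs hsk (-a)
    rw [neg_neg] at h
    rw [h]
    simp [hsk, hsk.symm]
  have h11 := key 1 1 one_ne_zero one_ne_zero
  -- The shared index is now the target of both edges, so the first shape is the flipped one.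
  rcases h11.2 with h | h
  · right
    constructor
    · intro a ha
      have := key (-a) 1 (neg_ne_zero.2 ha) one_ne_zero
      have := conv hik h1 a
      grind
    · intro a ha
      have := key 1 (-a) one_ne_zero (neg_ne_zero.2 ha)
      have := conv hjk h2 a
      grind
  · left
    constructor
    · intro a ha
      have := key (-a) 1 (neg_ne_zero.2 ha) one_ne_zero
      have := conv hik h1 a
      grind
    · intro a ha
      have := key 1 (-a) one_ne_zero (neg_ne_zero.2 ha)
      have := conv hjk h2 a
      grind

lemma ThreeCommonNeighbours.exists_third (h : ThreeCommonNeighbours ρ) (hρ : IsQuasiOrder ρ)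
    {i j : Fin n} (hr : ρ i j) (hij : i ≠ j) :
    ∃ k, k ≠ i ∧ k ≠ j ∧ ((ρ i k ∧ ρ j k) ∨ (ρ k i ∧ ρ k j) ∨ (ρ i k ∧ ρ k j)) := by
  by_contra! hc
  have h1 := h i j hr hij
  have h2 : ((image ρ i ∪ preimage ρ i) ∩ (image ρ j ∪ preimage ρ j)) ⊆ {i, j} := by
    rintro k ⟨hk1, hk2⟩
    simp only [image, preimage, Set.mem_union, Set.mem_ofPred_eq] at hk1 hk2
    have h3 := hc k
    have h4 := hρ.trans i j k
    have h5 := hρ.trans k i j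
    simp only [Set.mem_insert_iff, Set.mem_singleton_iff]
    tauto
  have h3 := Set.ncard_le_ncard h2
  rw [Set.ncard_pair hij] at h3
  omega

lemma Normalized.isFlipped_source_iff (hφ : Normalized hρ φ) {i j k : Fin n} (hij : i ≠ j)
    (hik : i ≠ k) (h1 : ρ i j) (h2 : ρ i k) : IsFlipped φ i j ↔ IsFlipped φ i k := by
  by_cases hjk : j = k
  · rw [hjk]
  rcases hφ.types_of_source hij hik hjk h1 h2 with h | h
  · simp [h.1.not_isFlipped, h.2.not_isFlipped]
  · simp [h]

lemma Normalized.isFlipped_target_iff (hφ : Normalized hρ φ) {i j k : Fin n}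
    (hik : i ≠ k) (hjk : j ≠ k) (h1 : ρ i k) (h2 : ρ j k) :
    IsFlipped φ i k ↔ IsFlipped φ j k := by
  by_cases hij : i = j
  · rw [hij]
  rcases hφ.types_of_target hij hik hjk h1 h2 with h | h
  · simp [h.1.not_isFlipped, h.2.not_isFlipped]
  · simp [h]

lemma Normalized.isPlain_or_isFlipped (hφ : Normalized hρ φ) (h3 : ThreeCommonNeighbours ρ)
    {i j : Fin n} (h1 : ρ i j) (hij : i ≠ j) : IsPlain φ i j ∨ IsFlipped φ i j := by
  obtain ⟨k, hki, hkj, ⟨h, -⟩ | ⟨-, h⟩ | ⟨h, -⟩⟩ := h3.exists_third hρ h1 hij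
  · exact (hφ.types_of_source hij hki.symm hkj.symm h1 h).imp And.left And.left
  · exact (hφ.types_of_target hki.symm hij hkj h1 h).imp And.left And.left
  · exact (hφ.types_of_source hij hki.symm hkj.symm h1 h).imp And.left And.left

/-- For equivalent `i` and `j` a third index lies above both or below both, and the type passes from
one direction to the other through it. -/
lemma Normalized.isFlipped_comm (hφ : Normalized hρ φ) (h3 : ThreeCommonNeighbours ρ)
    {i j : Fin n} (h1 : ρ i j) (h2 : ρ j i) (hij : i ≠ j) :
    IsFlipped φ i j ↔ IsFlipped φ j i := by
  have key : (∃ k, k ≠ i ∧ k ≠ j ∧ ((ρ i k ∧ ρ j k) ∨ (ρ k i ∧ ρ k j))) := by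
    obtain ⟨k, hki, hkj, h⟩ := h3.exists_third hρ h1 hij
    refine ⟨k, hki, hkj, ?_⟩
    have := hρ.trans j i k h2
    tauto
  obtain ⟨k, hki, hkj, ⟨ha, hb⟩ | ⟨ha, hb⟩⟩ := key
  · rw [hφ.isFlipped_source_iff hij hki.symm h1 ha,
      hφ.isFlipped_target_iff hki.symm hkj.symm ha hb,
      hφ.isFlipped_source_iff hkj.symm hij.symm hb h2]
  · rw [hφ.isFlipped_target_iff hij hkj h1 hb,
      hφ.isFlipped_source_iff hkj hki hb ha,
      hφ.isFlipped_target_iff hki hij.symm ha h2]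

lemma Normalized.isFlipped_chain (hφ : Normalized hρ φ) (h3 : ThreeCommonNeighbours ρ)
    {i j k : Fin n} (h1 : ρ i j) (h2 : ρ j k) (hij : i ≠ j) (hjk : j ≠ k) :
    IsFlipped φ i j ↔ IsFlipped φ j k := by
  by_cases hik : i = k
  · subst hik
    exact hφ.isFlipped_comm h3 h1 h2 hij
  have h4 := hρ.trans i j k h1 h2
  rw [hφ.isFlipped_source_iff hij hik h1 h4, hφ.isFlipped_target_iff hik hjk h4 h2]

/-- Some edge at the vertex `v` is flipped. -/
def IsFlippedVertex (ρ : Fin n → Fin n → Prop)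
    (φ : Matrix (Fin n) (Fin n) ℂ → Matrix (Fin n) (Fin n) ℂ) (v : Fin n) : Prop :=
  ∃ w, w ≠ v ∧ ((ρ v w ∧ IsFlipped φ v w) ∨ (ρ w v ∧ IsFlipped φ w v))

/-- All edges at a vertex have the same type, so the type is a property of vertices and is constant
along `ρ`. -/
lemma Normalized.isFlippedVertex_iff (hφ : Normalized hρ φ) (h3 : ThreeCommonNeighbours ρ)
    {i j : Fin n} (h1 : ρ i j) (hij : i ≠ j) :
    (IsFlippedVertex ρ φ i ↔ IsFlipped φ i j) ∧ (IsFlippedVertex ρ φ j ↔ IsFlipped φ i j) := by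
  refine ⟨⟨?_, fun h => ⟨j, hij.symm, Or.inl ⟨h1, h⟩⟩⟩, ⟨?_, fun h => ⟨i, hij, Or.inr ⟨h1, h⟩⟩⟩⟩
  · rintro ⟨w, hw, ⟨h, hf⟩ | ⟨h, hf⟩⟩
    · rwa [hφ.isFlipped_source_iff hij hw.symm h1 h]
    · rwa [← hφ.isFlipped_chain h3 h h1 hw hij]
  · rintro ⟨w, hw, ⟨h, hf⟩ | ⟨h, hf⟩⟩
    · rwa [hφ.isFlipped_chain h3 h1 h hij hw.symm]
    · rwa [hφ.isFlipped_target_iff hij hw h1 h]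

end Types

/-! ### Undoing the transposition on flipped components. -/

section PartialTranspose

variable {n : ℕ}

/-- The map `Y ↦ e Y + (1 - e) Yᵀ`. -/
def partialTranspose (e Y : Matrix (Fin n) (Fin n) ℂ) : Matrix (Fin n) (Fin n) ℂ :=
  e * Y + (1 - e) * Yᵀ

variable {e Y : Matrix (Fin n) (Fin n) ℂ}

lemma partialTranspose_mul (he : IsIdempotentElem e) (het : eᵀ = e) (hY : Commute e Y)
    (Z : Matrix (Fin n) (Fin n) ℂ) :
    partialTranspose e Y * partialTranspose e Z = e * (Y * Z) + (1 - e) * (Z * Y)ᵀ := by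
  have hYt : e * Yᵀ = Yᵀ * e := by
    have := congrArg transpose hY.eq
    simpa [het] using this.symm
  have h1 : e * Y * e = e * Y := by rw [mul_assoc, ← hY.eq, ← mul_assoc, he.eq]
  have h2 : (1 - e) * Yᵀ * e = 0 := by
    rw [mul_assoc, ← hYt, ← mul_assoc, sub_mul, one_mul, he.eq, sub_self, zero_mul]
  have h3 : partialTranspose e Y * e = e * Y := by
    rw [partialTranspose, add_mul, h1, h2, add_zero]
  have h4 : partialTranspose e Y * (1 - e) = (1 - e) * Yᵀ := by
    rw [mul_sub, mul_one, h3, partialTranspose, add_sub_cancel_left]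
  rw [partialTranspose.eq_def e Z, mul_add, ← mul_assoc, ← mul_assoc, h3, h4, transpose_mul,
    mul_assoc, mul_assoc]

lemma partialTranspose_transpose (het : eᵀ = e) (hY : Commute e Y) :
    (partialTranspose e Y)ᵀ = e * Yᵀ + (1 - e) * Y := by
  have hYt : e * Yᵀ = Yᵀ * e := by
    have := congrArg transpose hY.eq
    simpa [het] using this.symm
  rw [partialTranspose, transpose_add, transpose_mul, transpose_mul, transpose_transpose,
    transpose_sub, transpose_one, het, ← hYt, mul_sub, mul_one, ← hY.eq, sub_mul, one_mul]

lemma partialTranspose_partialTranspose (he : IsIdempotentElem e) (het : eᵀ = e)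
    (hY : Commute e Y) : partialTranspose e (partialTranspose e Y) = Y := by
  have h1 : e * (1 - e) = 0 := by rw [mul_sub, mul_one, he.eq, sub_self]
  have h2 : (1 - e) * e = 0 := by rw [sub_mul, one_mul, he.eq, sub_self]
  have h3 : (1 - e) * (1 - e) = 1 - e := he.one_sub.eq
  rw [partialTranspose.eq_def e (partialTranspose e Y), partialTranspose_transpose het hY,
    partialTranspose, mul_add, mul_add, ← mul_assoc, ← mul_assoc, ← mul_assoc, ← mul_assoc, he.eq,
    h1, h2, h3]
  noncomm_ring

lemma commute_partialTranspose (het : eᵀ = e) (hY : Commute e Y) :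
    Commute e (partialTranspose e Y) := by
  have hYt : Commute e Yᵀ := by
    have := congrArg transpose hY.eq
    simpa [het, Commute, SemiconjBy] using this.symm
  have h1 : Commute e (1 - e) := (Commute.one_right e).sub_right (Commute.refl e)
  exact ((Commute.refl e).mul_right hY).add_right (h1.mul_right hYt)

/-- Partial transposition maps `c - Z` to `c` minus the image of `Z` and preserves invertibility,
which gives one inclusion; being an involution, it gives the other. -/
lemma spectrum_partialTranspose (he : IsIdempotentElem e) (het : eᵀ = e) (hY : Commute e Y) :
    spectrum ℂ (partialTranspose e Y) = spectrum ℂ Y := by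
  have unit : ∀ Z : Matrix (Fin n) (Fin n) ℂ, Commute e Z → IsUnit Z →
      IsUnit (partialTranspose e Z) := by
    rintro Z hZ ⟨U, rfl⟩
    refine IsUnit.of_mul_eq_one (partialTranspose e U⁻¹.val) ?_
    rw [partialTranspose_mul he het hZ]
    simp
  have sub : ∀ Z : Matrix (Fin n) (Fin n) ℂ, Commute e Z →
      spectrum ℂ (partialTranspose e Z) ⊆ spectrum ℂ Z := by
    intro Z hZ c hc
    rw [spectrum.mem_iff] at hc ⊢
    refine fun h => hc ?_
    have h1 := unit _ ((Algebra.commute_algebraMap_right c e).sub_right hZ) h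
    convert h1 using 1
    simp only [partialTranspose, Algebra.algebraMap_eq_smul_one, transpose_sub, transpose_smul,
      transpose_one, mul_sub, sub_mul, mul_smul_comm, one_mul, mul_one]
    module
  refine (sub Y hY).antisymm ?_
  conv_lhs => rw [← partialTranspose_partialTranspose he het hY]
  exact sub _ (commute_partialTranspose het hY)

lemma continuous_partialTranspose (e : Matrix (Fin n) (Fin n) ℂ) :
    Continuous (partialTranspose e) := by
  unfold partialTranspose
  fun_prop

lemma partialTranspose_diagonal (e : Matrix (Fin n) (Fin n) ℂ) (d : Fin n → ℂ) :
    partialTranspose e (diagonal d) = diagonal d := by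
  rw [partialTranspose, diagonal_transpose]
  noncomm_ring

lemma partialTranspose_apply (p : Fin n → ℂ) (Y : Matrix (Fin n) (Fin n) ℂ) (k l : Fin n) :
    partialTranspose (diagonal p) Y k l = p k * Y k l + (1 - p k) * Y l k := by
  rw [partialTranspose, sub_mul, one_mul, Matrix.add_apply, Matrix.sub_apply, diagonal_mul,
    diagonal_mul, transpose_apply]
  ring

variable {ρ : Fin n → Fin n → Prop} {hρ : IsQuasiOrder ρ}
  {φ : Matrix (Fin n) (Fin n) ℂ → Matrix (Fin n) (Fin n) ℂ}

lemma commute_diagonal_of_mem {p : Fin n → ℂ} (hp : ∀ i j, ρ i j → p i = p j)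
    {X : Matrix (Fin n) (Fin n) ℂ} (hX : X ∈ structuralMatrixAlgebra ρ hρ) :
    Commute (diagonal p) X := by
  ext k l
  rw [diagonal_mul, mul_diagonal]
  by_cases h : X k l = 0
  · simp [h]
  · rw [hp k l (hX k l h), mul_comm]

lemma isIdempotentElem_diagonal {p : Fin n → ℂ} (hp : ∀ i, p i = 0 ∨ p i = 1) :
    IsIdempotentElem (diagonal p) := by
  rw [IsIdempotentElem, diagonal_mul_diagonal]
  congr 1
  ext i
  rcases hp i with h | h <;> simp [h]

/-- As `p` is constant along `ρ`, `diagonal p` is central in the algebra. It is fixed by `φ`, so it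
also commutes with the whole image. -/
lemma Normalized.partialTranspose (hφ : Normalized hρ φ) {p : Fin n → ℂ}
    (hp : ∀ i, p i = 0 ∨ p i = 1) (hp' : ∀ i j, ρ i j → p i = p j) :
    Normalized hρ fun X => partialTranspose (diagonal p) (φ X) := by
  have he := isIdempotentElem_diagonal hp
  have het : (diagonal p)ᵀ = diagonal p := diagonal_transpose p
  have hc : ∀ X ∈ structuralMatrixAlgebra ρ hρ, Commute (diagonal p) (φ X) := by
    intro X hX
    rw [← hφ.diag p]
    exact hφ.comm _ (diagonal_mem hρ p) X hX (commute_diagonal_of_mem hp' hX)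
  refine ⟨⟨?_, ?_, ?_, ?_⟩, ?_⟩
  · intro X hX Y hY h
    have h1 := congrArg (SMA.partialTranspose (diagonal p)) h
    simp only [partialTranspose_partialTranspose he het (hc _ hX),
      partialTranspose_partialTranspose he het (hc _ hY)] at h1
    exact hφ.inj hX hY h1
  · exact (continuous_partialTranspose _).comp_continuousOn hφ.cont
  · intro X hX Y hY h
    have h1 := (hφ.comm X hX Y hY h).eq
    rw [Commute, SemiconjBy, partialTranspose_mul he het (hc _ hX),
      partialTranspose_mul he het (hc _ hY), h1]
  · intro X hX
    rw [spectrum_partialTranspose he het (hc _ hX), hφ.spec X hX]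
  · intro d
    simp only [hφ.diag, partialTranspose_diagonal]

lemma Normalized.exists_partialTranspose_isPlain (hφ : Normalized hρ φ)
    (h3 : ThreeCommonNeighbours ρ) :
    ∃ p : Fin n → ℂ, (∀ i, p i = 0 ∨ p i = 1) ∧ (∀ i j, ρ i j → p i = p j) ∧
      ∀ i j, ρ i j → i ≠ j → IsPlain (fun X => SMA.partialTranspose (diagonal p) (φ X)) i j := by
  classical
  refine ⟨fun i => if IsFlippedVertex ρ φ i then 0 else 1, fun i => ?_, fun i j h => ?_,
    fun i j h hij a ha => ?_⟩
  · by_cases h : IsFlippedVertex ρ φ i <;> simp [h]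
  · by_cases hij : i = j
    · rw [hij]
    · have h1 := hφ.isFlippedVertex_iff h3 h hij
      simp only [h1]
  · have h1 := hφ.isFlippedVertex_iff h3 h hij
    simp only [partialTranspose_apply, h1]
    rcases hφ.isPlain_or_isFlipped h3 h hij with h2 | h2
    · have := h2 a ha
      simpa [h2.not_isFlipped] using this
    · have := h2 a ha
      simpa [h2] using this

end PartialTranspose

/-! ### Linearity along edges and the transitive map. -/

section Linearity

variable {n : ℕ} {ρ : Fin n → Fin n → Prop} {hρ : IsQuasiOrder ρ}
  {φ : Matrix (Fin n) (Fin n) ℂ → Matrix (Fin n) (Fin n) ℂ}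

lemma Normalized.map_colIdem (hφ : Normalized hρ φ) {i j : Fin n} (h : ρ i j) (hij : i ≠ j)
    (hp : IsPlain φ i j) (a : ℂ) :
    φ (colIdem i j a) = colIdem i j (φ (colIdem i j a) i j) := by
  by_cases ha : a = 0
  · subst ha
    rw [colIdem_zero, hφ.diag, diagonal_apply_ne _ hij, colIdem_zero]
  ext k l
  have h1 := hφ.map_colIdem_supportedOn h hij a k l
  have h2 := hp a ha
  rw [colIdem_apply]
  grind

lemma Normalized.map_rowIdem_eq (hφ : Normalized hρ φ) {i j : Fin n} (h : ρ i j) (hij : i ≠ j)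
    (hp : IsPlain φ i j) (a : ℂ) :
    φ (rowIdem i j a) = rowIdem i j (-φ (colIdem i j (-a)) i j) := by
  rw [hφ.map_rowIdem h hij, hφ.map_colIdem h hij hp, ← rowIdem_add_colIdem hij, add_sub_assoc,
    add_eq_left, sub_eq_zero]
  congr 1
  simp [colIdem_apply, hij]

/-- The value of `φ` at `(b, c, 1)ᵀ e_kᵀ` links the entries of the images of the idempotents at the
three edges of a chain `i, j, k`. -/
lemma Normalized.entry_mul_entry (hφ : Normalized hρ φ) {i j k : Fin n} (hij : i ≠ j) (hik : i ≠ k)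
    (hjk : j ≠ k) (h1 : ρ i j) (h2 : ρ j k) (p1 : IsPlain φ i j) (p2 : IsPlain φ j k)
    (p3 : IsPlain φ i k) (t s : ℂ) :
    φ (colIdem i k (t * s)) i k = φ (colIdem i j t) i j * φ (colIdem j k s) j k := by
  have h3 := hρ.trans i j k h1 h2
  set x : Fin n → ℂ := Pi.single i (t * s) + Pi.single j s + Pi.single k 1 with hx
  set y : Fin n → ℂ := Pi.single k 1 with hy
  have xi : x i = t * s := by simp [hx, hy, hij, hik]
  have xj : x j = s := by simp [hx, hy, hij.symm, hjk]
  have xk : x k = 1 := by simp [hx, hy, hik.symm, hjk.symm]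
  have xl : ∀ l, l ≠ i → l ≠ j → l ≠ k → x l = 0 := by
    intro l hi hj hk
    simp [hx, hy, hi, hj, hk]
  have hyx : y ⬝ᵥ x = 1 := by simp [hy, xk]
  have hxy : vecMulVec x y ∈ structuralMatrixAlgebra ρ hρ := by
    refine vecMulVec_mem fun l m hl hm => ?_
    have hm' : m = k := by
      by_contra h
      simp [hy, h] at hm
    subst hm'
    by_contra hc
    refine hl (xl l ?_ ?_ ?_) <;> rintro rfl
    · exact hc h3
    · exact hc h2
    · exact hc (hρ.refl _)
  set B := φ (vecMulVec x y) with hB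
  -- The idempotent `rowIdem a b (-u)` is orthogonal to `x yᵀ` when `x a = u * x b`; its known image
  -- makes row `a` of `B` a multiple of row `b`.
  have row : ∀ {a b : Fin n}, a ≠ b → b ≠ i → a ≠ k → ρ a b → IsPlain φ a b → ∀ u, x a = u * x b →
      ∀ l, B a l = φ (colIdem a b u) a b * B b l := by
    intro a b hab hbi hak hr hp u hu l
    have h := (hφ.mulVec_eq_zero_of_map_eq hxy (rowIdem_mem hr (-u)) hyx
      (by rw [single_add_single_dotProduct]; simp [hab.symm])
      (by simp [hy, hak.symm])
      (by rw [single_add_single_dotProduct, hu]; ring)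
      (hφ.map_rowIdem_eq hr hab hp (-u))).2
    have h4 := congrFun h l
    rw [add_vecMul, neg_neg] at h4
    simp only [Pi.add_apply, single_vecMul, Pi.smul_apply, row, smul_eq_mul, one_mul,
      Pi.zero_apply] at h4
    linear_combination h4
  have r1 := row hij hij.symm hik h1 p1 t (by rw [xi, xj])
  have r2 := row hjk hik.symm hjk h2 p2 s (by rw [xj, xk, mul_one])
  have r3 := row hik hik.symm hik h3 p3 (t * s) (by rw [xi, xk, mul_one])
  -- Rows `i` and `j` are multiples of row `k` and the other rows vanish, so row `k` of `B ≠ 0` is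
  -- nonzero.
  obtain ⟨l, hl⟩ : ∃ l, B k l ≠ 0 := by
    by_contra! hc
    refine hφ.map_ne_zero (diagonal_mem hρ) hxy ?_ ?_
    · rw [Ne, vecMulVec_eq_zero]
      rintro (h | h) <;> simp [h] at hyx
    · ext m l
      change B m l = 0
      by_cases hmk : m = k
      · rw [hmk, hc]
      by_cases hmi : m = i
      · rw [hmi, r3, hc, mul_zero]
      by_cases hmj : m = j
      · rw [hmj, r2, hc, mul_zero]
      exact (hφ.map_vecMulVec_apply_eq_zero hxy hyx (xl m hmi hmj hmk) (by simp [hy, hmk]) l).1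
  apply mul_right_cancel₀ hl
  rw [← r3, r1, r2, mul_assoc]

lemma single_mem {i j : Fin n} (h : ρ i j) (a : ℂ) :
    single i j a ∈ structuralMatrixAlgebra ρ hρ := by
  intro k l hkl
  rw [single_apply] at hkl
  grind

/-- By homogeneity, `a⁻¹ φ(E_jj + a E_ij) = φ(E_ij + a⁻¹ E_jj)`, and continuity applies as `a⁻¹ →
0`. -/
lemma Normalized.tendsto_entry (hφ : Normalized hρ φ) {i j : Fin n} (h : ρ i j) (k l : Fin n) :
    Tendsto (fun a => a⁻¹ * φ (colIdem i j a) k l) (Bornology.cobounded ℂ)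
      (𝓝 (φ (single i j 1) k l)) := by
  have hmem : ∀ a : ℂ, single i j 1 + a • colIdem i j 0 ∈ structuralMatrixAlgebra ρ hρ := fun a =>
    Subalgebra.add_mem _ (single_mem h 1) (Subalgebra.smul_mem _ (colIdem_mem h 0) a)
  have hc : Continuous fun a : ℂ => φ (single i j 1 + a • colIdem i j 0) :=
    hφ.cont.comp_continuous (by fun_prop) hmem
  have h1 : Tendsto (fun a : ℂ => φ (single i j 1 + a • colIdem i j 0) k l) (𝓝 0)
      (𝓝 (φ (single i j 1) k l)) := by
    have := (hc.matrix_elem k l).tendsto 0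
    simpa using this
  refine (h1.comp (tendsto_inv₀_cobounded (α := ℂ))).congr' ?_
  filter_upwards [Bornology.eventually_ne_cobounded (0 : ℂ)] with a ha
  have ha : a ≠ 0 := ha
  have h2 : single i j 1 + a⁻¹ • colIdem i j 0 = a⁻¹ • colIdem i j a := by
    ext k l
    simp only [Matrix.add_apply, Matrix.smul_apply, colIdem_apply, single_apply, smul_eq_mul]
    have := inv_mul_cancel₀ ha
    grind
  rw [Function.comp_apply, h2, hφ.map_smul (diagonal_mem hρ) (colIdem_mem h a)]
  rfl

/-- The entries of `φ (colIdem i j a)` away from `(i, j)` do not depend on `a`, so they disappear in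
the limit; the remaining entry is nonzero by injectivity. -/
lemma Normalized.entry_ne_zero (hφ : Normalized hρ φ) {i j : Fin n} (h : ρ i j) (hij : i ≠ j)
    (hp : IsPlain φ i j) : φ (single i j 1) i j ≠ 0 := by
  intro h0
  refine hφ.map_ne_zero (diagonal_mem hρ) (single_mem (hρ := hρ) h 1) ?_ ?_
  · intro h1
    have := congrFun (congrFun h1 i) j
    simp at this
  · ext k l
    by_cases hkl : k = i ∧ l = j
    · rw [hkl.1, hkl.2, h0]; rfl
    · refine tendsto_nhds_unique (hφ.tendsto_entry h k l) ?_
      have h1 := (tendsto_inv₀_cobounded (α := ℂ)).mul_const (if k = j ∧ l = j then (1 : ℂ) else 0)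
      rw [zero_mul] at h1
      refine h1.congr fun a => ?_
      rw [hφ.map_colIdem h hij hp, colIdem_apply]
      congr 1
      grind

/-- All three edges of a chain are mapped linearly. -/
lemma Normalized.linear_of_chain (hφ : Normalized hρ φ) {i j k : Fin n} (hij : i ≠ j) (hik : i ≠ k)
    (hjk : j ≠ k) (h1 : ρ i j) (h2 : ρ j k) (p1 : IsPlain φ i j) (p2 : IsPlain φ j k)
    (p3 : IsPlain φ i k) :
    (∀ a, φ (colIdem i j a) i j = φ (single i j 1) i j * a) ∧
    (∀ a, φ (colIdem j k a) j k = φ (single j k 1) j k * a) ∧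
    (∀ a, φ (colIdem i k a) i k = φ (single i k 1) i k * a) ∧
    φ (single i j 1) i j * φ (single j k 1) j k = φ (single i k 1) i k := by
  have h3 := hρ.trans i j k h1 h2
  have e := hφ.entry_mul_entry hij hik hjk h1 h2 p1 p2 p3
  have t1 := hφ.tendsto_entry h1 i j
  have t2 := hφ.tendsto_entry h2 j k
  have t3 := hφ.tendsto_entry h3 i k
  have n1 := hφ.entry_ne_zero h1 hij p1
  have n2 := hφ.entry_ne_zero h2 hjk p2
  have n0 : ∀ᶠ a in Bornology.cobounded ℂ, a ≠ 0 :=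
    Bornology.eventually_ne_cobounded (0 : ℂ)
  set g1 := φ (single i j 1) i j
  set g2 := φ (single j k 1) j k
  set g3 := φ (single i k 1) i k
  -- Divide `f_ik (t s) = f_ij t * f_jk s` by `s` and let `s → ∞`.
  have a1 : ∀ t, φ (colIdem i j t) i j * g2 = t * g3 := by
    intro t
    by_cases ht : t = 0
    · rw [ht, colIdem_zero, hφ.diag, diagonal_apply_ne _ hij]; simp
    refine tendsto_nhds_unique (t2.const_mul _) (((t3.comp
      (tendsto_mul_left_cobounded ht)).const_mul t).congr' ?_)
    filter_upwards [n0] with s hs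
    simp only [Function.comp_apply, e]
    field_simp
  have l1 : ∀ t, φ (colIdem i j t) i j = g1 * t := by
    have h4 : g1 = g3 / g2 := by
      refine tendsto_nhds_unique t1 (tendsto_const_nhds.congr' ?_)
      filter_upwards [n0] with s hs
      have := a1 s
      field_simp
      linear_combination -this
    intro t
    have := a1 t
    rw [h4]
    field_simp
    linear_combination this
  have h4 : g1 * g2 = g3 := by
    have := a1 1
    rw [l1] at this
    linear_combination this
  have e1 : ∀ s, φ (colIdem i k s) i k = g1 * φ (colIdem j k s) j k := by
    intro s
    have := e 1 s
    rwa [one_mul, l1, mul_one] at this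
  -- With `f_ij` known to be linear, divide by `t` and let `t → ∞`.
  have l2 : ∀ s, φ (colIdem j k s) j k = g2 * s := by
    intro s
    by_cases hs : s = 0
    · rw [hs, colIdem_zero, hφ.diag, diagonal_apply_ne _ hjk]; simp
    have h5 : g1 * φ (colIdem j k s) j k = g3 * s := by
      refine tendsto_nhds_unique (a := g1 * φ (colIdem j k s) j k)
        (f := fun t : ℂ => t⁻¹ * φ (colIdem i k (t * s)) i k) (l := Bornology.cobounded ℂ) ?_ ?_
      · refine tendsto_const_nhds.congr' ?_
        filter_upwards [n0] with t ht
        rw [e, l1]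
        field_simp
      · refine ((t3.comp (tendsto_mul_right_cobounded hs)).mul_const s).congr' ?_
        filter_upwards [n0] with t ht
        simp only [Function.comp_apply]
        field_simp
    apply mul_left_cancel₀ n1
    rw [h5, ← h4, mul_assoc]
  refine ⟨l1, l2, fun s => ?_, h4⟩
  rw [e1, l2, ← h4, mul_assoc]

lemma Normalized.exists_isTransitiveMap (hφ : Normalized hρ φ) (h3 : ThreeCommonNeighbours ρ)
    (hp : ∀ i j, ρ i j → i ≠ j → IsPlain φ i j) :
    ∃ g : Fin n → Fin n → ℂˣ, IsTransitiveMap ρ g ∧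
      ∀ i j, ρ i j → i ≠ j → ∀ a, φ (colIdem i j a) = colIdem i j (g i j * a) := by
  have chain := fun i j k (hij : i ≠ j) (hik : i ≠ k) (hjk : j ≠ k) (h1 : ρ i j) (h2 : ρ j k) =>
    hφ.linear_of_chain hij hik hjk h1 h2 (hp i j h1 hij) (hp j k h2 hjk)
      (hp i k (hρ.trans i j k h1 h2) hik)
  set γ : Fin n → Fin n → ℂ := fun i j => φ (single i j 1) i j with hγ
  have γ1 : ∀ i, γ i i = 1 := by
    intro i
    simp only [hγ]
    rw [← diagonal_single, hφ.diag]
    simp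
  have γ0 : ∀ i j, ρ i j → γ i j ≠ 0 := by
    intro i j h
    by_cases hij : i = j
    · rw [hij, γ1]; exact one_ne_zero
    · exact hφ.entry_ne_zero h hij (hp i j h hij)
  -- A pair of equivalent indices is no chain of three distinct indices; the relation comes from two
  -- chains through a third index.
  have γinv : ∀ i j, i ≠ j → ρ i j → ρ j i → γ i j * γ j i = 1 := by
    intro i j hij h1 h2
    obtain ⟨k, hki, hkj, ⟨ha, hb⟩ | ⟨ha, hb⟩⟩ :
        ∃ k, k ≠ i ∧ k ≠ j ∧ ((ρ i k ∧ ρ j k) ∨ (ρ k i ∧ ρ k j)) := by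
      obtain ⟨k, hki, hkj, h⟩ := h3.exists_third hρ h1 hij
      refine ⟨k, hki, hkj, ?_⟩
      have := hρ.trans j i k h2
      tauto
    · have e1 := (chain i j k hij hki.symm hkj.symm h1 hb).2.2.2
      have e2 := (chain j i k hij.symm hkj.symm hki.symm h2 ha).2.2.2
      apply mul_right_cancel₀ (γ0 i k ha)
      rw [mul_assoc, one_mul]
      exact (congrArg (γ i j * ·) e2).trans e1
    · have e1 := (chain k i j hki hkj hij ha h1).2.2.2
      have e2 := (chain k j i hkj hki hij.symm hb h2).2.2.2
      apply mul_left_cancel₀ (γ0 k i ha)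
      rw [← mul_assoc, mul_one]
      exact (congrArg (· * γ j i) e1).trans e2
  have γtrans : ∀ i j k, ρ i j → ρ j k → γ i j * γ j k = γ i k := by
    intro i j k h1 h2
    by_cases hij : i = j
    · subst hij; rw [γ1, one_mul]
    by_cases hjk : j = k
    · subst hjk; rw [γ1, mul_one]
    by_cases hik : i = k
    · subst hik; rw [γ1]; exact γinv i j hij h1 h2
    exact (chain i j k hij hik hjk h1 h2).2.2.2
  classical
  refine ⟨fun i j => if h : γ i j ≠ 0 then Units.mk0 _ h else 1, ?_, ?_⟩
  · intro i j k h1 h2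
    ext
    simp only [γ0 i j h1, γ0 j k h2, γ0 i k (hρ.trans i j k h1 h2), ne_eq, not_false_eq_true,
      dite_true, Units.val_mul, Units.val_mk0]
    exact γtrans i j k h1 h2
  · intro i j h hij a
    rw [hφ.map_colIdem h hij (hp i j h hij)]
    congr 1
    simp only [γ0 i j h, ne_eq, not_false_eq_true, dite_true, Units.val_mk0]
    obtain ⟨k, hki, hkj, ⟨-, hb⟩ | ⟨ha, -⟩ | ⟨ha, hb⟩⟩ := h3.exists_third hρ h hij
    · exact (chain i j k hij hki.symm hkj.symm h hb).1 a
    · exact (chain k i j hki hkj hij ha h).2.1 a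
    · exact (chain i k j hki.symm hij hkj ha hb).2.2.1 a

end Linearity

/-! ### Dividing out the transitive map. -/

section Automorphism

variable {n : ℕ} {ρ : Fin n → Fin n → Prop} {hρ : IsQuasiOrder ρ}
  {φ : Matrix (Fin n) (Fin n) ℂ → Matrix (Fin n) (Fin n) ℂ}

/-- Left multiplication by `X` is injective on the finite-dimensional algebra, hence surjective, so
the inverse lies in the algebra. -/
lemma isUnit_coe_iff (A : Subalgebra ℂ (Matrix (Fin n) (Fin n) ℂ)) (X : A) :
    IsUnit (X : Matrix (Fin n) (Fin n) ℂ) ↔ IsUnit X := by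
  refine ⟨fun h => ?_, fun h => h.map A.val⟩
  have hinj : Function.Injective (LinearMap.mulLeft ℂ X) := by
    intro Y Z hYZ
    exact Subtype.ext (h.mul_left_cancel (congrArg Subtype.val hYZ))
  obtain ⟨Y, hY⟩ := LinearMap.surjective_of_injective hinj 1
  exact IsUnit.of_mul_eq_one Y hY

lemma spectrum_coe (A : Subalgebra ℂ (Matrix (Fin n) (Fin n) ℂ)) (X : A) :
    spectrum ℂ (X : Matrix (Fin n) (Fin n) ℂ) = spectrum ℂ X := by
  ext c
  rw [spectrum.mem_iff, spectrum.mem_iff, ← isUnit_coe_iff]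
  rfl

lemma IsTransitiveMap.self {g : Fin n → Fin n → ℂˣ} (hg : IsTransitiveMap ρ g)
    (hρ : IsQuasiOrder ρ) (i : Fin n) : g i i = 1 := by
  simpa using hg i i i (hρ.refl i) (hρ.refl i)

/-- Entrywise division by the values of `g`. -/
def entrywiseDiv (g : Fin n → Fin n → ℂˣ) (X : Matrix (Fin n) (Fin n) ℂ) :
    Matrix (Fin n) (Fin n) ℂ :=
  Matrix.of fun i j => ((g i j)⁻¹ : ℂˣ) * X i j

lemma entrywiseDiv_eq_symm {g : Fin n → Fin n → ℂˣ} (hg : IsTransitiveMap ρ g)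
    (X : structuralMatrixAlgebra ρ hρ) :
    entrywiseDiv g X = ((inducedAut hρ hg).symm X : Matrix (Fin n) (Fin n) ℂ) := rfl

lemma Normalized.comp_entrywiseDiv (hφ : Normalized hρ φ) {g : Fin n → Fin n → ℂˣ}
    (hg : IsTransitiveMap ρ g) : Normalized hρ fun X => φ (entrywiseDiv g X) := by
  have hmem : ∀ X ∈ structuralMatrixAlgebra ρ hρ,
      entrywiseDiv g X ∈ structuralMatrixAlgebra ρ hρ :=
    fun X hX => ((inducedAut hρ hg).symm ⟨X, hX⟩).2
  refine ⟨⟨?_, ?_, ?_, ?_⟩, ?_⟩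
  · intro X hX Y hY h
    have h1 := hφ.inj (hmem X hX) (hmem Y hY) h
    ext i j
    have h2 := congrFun (congrFun h1 i) j
    simpa [entrywiseDiv] using h2
  · refine hφ.cont.comp (Continuous.continuousOn ?_) hmem
    unfold entrywiseDiv
    fun_prop
  · intro X hX Y hY h
    refine hφ.comm _ (hmem X hX) _ (hmem Y hY) ?_
    have h1 : Commute (⟨X, hX⟩ : structuralMatrixAlgebra ρ hρ) ⟨Y, hY⟩ := Subtype.ext h.eq
    exact congrArg Subtype.val (h1.map (inducedAut hρ hg).symm).eq
  · intro X hX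
    rw [hφ.spec _ (hmem X hX), entrywiseDiv_eq_symm hg ⟨X, hX⟩, spectrum_coe,
      AlgEquiv.spectrum_eq, ← spectrum_coe]
  · intro d
    have : entrywiseDiv g (diagonal d) = diagonal d := by
      ext i j
      by_cases hij : i = j
      · subst hij; simp [entrywiseDiv, hg.self hρ]
      · simp [entrywiseDiv, hij]
    simp only [this, hφ.diag]

lemma entrywiseDiv_colIdem {g : Fin n → Fin n → ℂˣ} (hg : IsTransitiveMap ρ g)
    (hρ : IsQuasiOrder ρ) {i j : Fin n} (a : ℂ) :
    entrywiseDiv g (colIdem i j (g i j * a)) = colIdem i j a := by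
  ext k l
  have h1 := hg.self hρ j
  simp only [entrywiseDiv, of_apply, colIdem_apply]
  by_cases hl : l = j
  · subst hl
    by_cases hkj : k = l
    · subst hkj
      by_cases hki : k = i
      · subst hki; simp [h1]
      · simp [h1, hki]
    · by_cases hki : k = i
      · subst hki; simp [hkj]
      · simp [hki, hkj]
  · simp [hl]

end Automorphism

/-! ### All rank-one idempotents are fixed. -/

section RankOne

variable {n : ℕ} {ρ : Fin n → Fin n → Prop} {hρ : IsQuasiOrder ρ}
  {φ : Matrix (Fin n) (Fin n) ℂ → Matrix (Fin n) (Fin n) ℂ}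

/-- Proportional rows and columns make `A` a multiple of `x yᵀ`, and idempotency fixes the factor as
`1`. -/
lemma eq_vecMulVec_of_proportional {A : Matrix (Fin n) (Fin n) ℂ} {x y : Fin n → ℂ} {i : Fin n}
    (hx : x i ≠ 0) (hy : y i ≠ 0) (hyx : y ⬝ᵥ x = 1) (iA : IsIdempotentElem A) (hA : A ≠ 0)
    (hr : ∀ k l, A k l * x i = x k * A i l) (hc : ∀ k l, A l k * y i = y k * A l i) :
    A = vecMulVec x y := by
  have h1 : A = (A i i / (x i * y i)) • vecMulVec x y := by
    ext k l
    rw [Matrix.smul_apply, vecMulVec_apply, smul_eq_mul]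
    field_simp
    linear_combination y i * hr k l + x k * hc l i
  set c := A i i / (x i * y i)
  have hc0 : c ≠ 0 := by
    intro h
    rw [h, zero_smul] at h1
    exact hA h1
  have h2 : c * c = c := by
    have h3 := congrFun (congrFun iA.eq i) i
    rw [h1, smul_mul_smul, vecMulVec_mul_vecMulVec, hyx, one_smul, Matrix.smul_apply,
      Matrix.smul_apply, vecMulVec_apply, smul_eq_mul, smul_eq_mul] at h3
    exact mul_right_cancel₀ (mul_ne_zero hx hy) h3
  rw [h1, mul_right_cancel₀ hc0 (h2.trans (one_mul c).symm), one_smul]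

/-- `φ` fixes all the idempotents `E_jj + a E_ij` of the algebra. -/
def FixesColIdem (ρ : Fin n → Fin n → Prop)
    (φ : Matrix (Fin n) (Fin n) ℂ → Matrix (Fin n) (Fin n) ℂ) : Prop :=
  ∀ i j, ρ i j → i ≠ j → ∀ a, φ (colIdem i j a) = colIdem i j a

lemma Normalized.map_rowIdem_of_fixes (hφ : Normalized hρ φ) (hf : FixesColIdem ρ φ) {i j : Fin n}
    (h : ρ i j) (hij : i ≠ j) (a : ℂ) : φ (rowIdem i j a) = rowIdem i j a := by
  rw [hφ.map_rowIdem h hij, hf i j h hij, ← rowIdem_add_colIdem hij a, add_sub_cancel_right]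

lemma rel_of_mem {x y : Fin n → ℂ} (hxy : vecMulVec x y ∈ structuralMatrixAlgebra ρ hρ)
    {i j : Fin n} (hx : x i ≠ 0) (hy : y j ≠ 0) : ρ i j :=
  hxy i j (by rw [vecMulVec_apply]; exact mul_ne_zero hx hy)

/-- Rows and columns with an index outside of one of the supports of `x` and `y`. -/
lemma Normalized.proportional_of_eq_zero (hφ : Normalized hρ φ) (hf : FixesColIdem ρ φ)
    {x y : Fin n → ℂ} (hxy : vecMulVec x y ∈ structuralMatrixAlgebra ρ hρ) (hyx : y ⬝ᵥ x = 1)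
    {i k : Fin n} (hx : x i ≠ 0) (hy : y i ≠ 0) (hk : x k = 0 ∨ y k = 0) (l : Fin n) :
    φ (vecMulVec x y) k l * x i = x k * φ (vecMulVec x y) i l ∧
      φ (vecMulVec x y) l k * y i = y k * φ (vecMulVec x y) l i := by
  have hki : k ≠ i := by rintro rfl; tauto
  by_cases hxk : x k = 0
  · by_cases hyk : y k = 0
    · have := hφ.map_vecMulVec_apply_eq_zero hxy hyx hxk hyk l
      simp [this, hxk, hyk]
    · have hr := rel_of_mem hxy hx hyk
      -- The vector `e_k - (y k / y i) e_i` is orthogonal to `y`, and `e_k` is orthogonal to `x`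
      -- because `x k = 0`.
      have h := hφ.mulVec_eq_zero_of_map_eq hxy (colIdem_mem hr (-(y k / y i))) hyx
        (by rw [dotProduct_single_add_single]; simp [hki])
        (by rw [dotProduct_single_add_single]; field_simp; ring)
        (by simp [hxk]) (hf i k hr hki.symm _)
      have h1 := congrFun h.1 l
      have h2 := congrFun h.2 l
      simp only [mulVec_add, mulVec_single, single_vecMul, Pi.add_apply, Pi.zero_apply,
        Pi.smul_apply, col_apply, row_apply, smul_eq_mul, MulOpposite.smul_eq_mul_unop,
        MulOpposite.unop_op, one_mul, mul_one] at h1 h2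
      rw [h2, hxk]
      refine ⟨by ring, ?_⟩
      field_simp at h1
      linear_combination h1
  · have hyk : y k = 0 := hk.resolve_left hxk
    have hr := rel_of_mem hxy hxk hy
    have h := hφ.mulVec_eq_zero_of_map_eq hxy (rowIdem_mem hr (-(x k / x i))) hyx
      (by rw [single_add_single_dotProduct]; simp [hki])
      (by simp [hyk])
      (by rw [single_add_single_dotProduct]; field_simp; ring)
      (hφ.map_rowIdem_of_fixes hf hr hki _)
    have h1 := congrFun h.1 l
    have h2 := congrFun h.2 l
    simp only [add_vecMul, mulVec_single, single_vecMul, Pi.add_apply, Pi.zero_apply,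
      Pi.smul_apply, col_apply, row_apply, smul_eq_mul, MulOpposite.smul_eq_mul_unop,
      MulOpposite.unop_op, one_mul, mul_one] at h1 h2
    rw [h1, hyk]
    refine ⟨?_, by ring⟩
    field_simp at h2
    linear_combination h2

lemma Normalized.map_vecMulVec_of_proportional (hφ : Normalized hρ φ)
    {x y : Fin n → ℂ} (hxy : vecMulVec x y ∈ structuralMatrixAlgebra ρ hρ) (hyx : y ⬝ᵥ x = 1)
    {i : Fin n} (hx : x i ≠ 0) (hy : y i ≠ 0)
    (h : ∀ k l, φ (vecMulVec x y) k l * x i = x k * φ (vecMulVec x y) i l ∧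
      φ (vecMulVec x y) l k * y i = y k * φ (vecMulVec x y) l i) :
    φ (vecMulVec x y) = vecMulVec x y := by
  have h0 : vecMulVec x y ≠ 0 := by
    rw [Ne, vecMulVec_eq_zero]
    rintro (rfl | rfl) <;> simp at hyx
  exact eq_vecMulVec_of_proportional hx hy hyx
    (hφ.map_isIdempotentElem (diagonal_mem hρ) hxy (isIdempotentElem_vecMulVec hyx))
    (hφ.map_ne_zero (diagonal_mem hρ) hxy h0) (fun k l => (h k l).1) (fun k l => (h k l).2)

lemma Normalized.map_vecMulVec_of_overlap (hφ : Normalized hρ φ) (hf : FixesColIdem ρ φ)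
    {x y : Fin n → ℂ} (hxy : vecMulVec x y ∈ structuralMatrixAlgebra ρ hρ) (hyx : y ⬝ᵥ x = 1)
    {i : Fin n} (hx : x i ≠ 0) (hy : y i ≠ 0) (hk : ∀ k, k ≠ i → x k = 0 ∨ y k = 0) :
    φ (vecMulVec x y) = vecMulVec x y := by
  refine hφ.map_vecMulVec_of_proportional hxy hyx hx hy fun k l => ?_
  by_cases hki : k = i
  · subst hki; exact ⟨mul_comm _ _, mul_comm _ _⟩
  · exact hφ.proportional_of_eq_zero hf hxy hyx hx hy (hk k hki) l

/-- Three common indices of the supports of `x` and `y`. -/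
lemma Normalized.proportional_of_three (hφ : Normalized hρ φ) (hf : FixesColIdem ρ φ)
    {x y : Fin n → ℂ} (hxy : vecMulVec x y ∈ structuralMatrixAlgebra ρ hρ) (hyx : y ⬝ᵥ x = 1)
    {i a c : Fin n} (hai : a ≠ i) (hac : a ≠ c) (hci : c ≠ i) (hx : x i ≠ 0) (hy : y i ≠ 0)
    (hxa : x a ≠ 0) (hya : y a ≠ 0) (hxc : x c ≠ 0) (hyc : y c ≠ 0) (l : Fin n) :
    φ (vecMulVec x y) a l * x i = x a * φ (vecMulVec x y) i l ∧
      φ (vecMulVec x y) l a * y i = y a * φ (vecMulVec x y) l i := by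
  have rel : ∀ s t, (s = a ∨ s = i ∨ s = c) → (t = a ∨ t = i ∨ t = c) → ρ s t := by
    intro s t hs ht
    refine rel_of_mem hxy ?_ ?_
    · rcases hs with rfl | rfl | rfl <;> assumption
    · rcases ht with rfl | rfl | rfl <;> assumption
  -- The vectors `e_a - (y a / y t) e_t` and `e_a - (x a / x s) e_s` are orthogonal to `y` and `x`.
  -- Because `s ≠ t`, their supports meet only in `a`, so their idempotent is already known to be
  -- fixed. The third common index is what allows `s ≠ t`.
  have key : ∀ s t, s ≠ a → t ≠ a → s ≠ t → (s = i ∨ s = c) → (t = i ∨ t = c) →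
      x s ≠ 0 → y t ≠ 0 →
      φ (vecMulVec x y) *ᵥ (Pi.single a 1 + Pi.single t (-(y a / y t))) = 0 ∧
        (Pi.single a 1 + Pi.single s (-(x a / x s))) ᵥ* φ (vecMulVec x y) = 0 := by
    intro s t hsa hta hst hs ht hxs hyt
    have hsup : ∀ (u : ℂ) (r k : Fin n), (Pi.single a 1 + Pi.single r u : Fin n → ℂ) k ≠ 0 →
        k = a ∨ k = r := by
      intro u r k h
      by_contra! hc
      simp [hc.1, hc.2] at h
    have hm : vecMulVec (Pi.single a 1 + Pi.single t (-(y a / y t)))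
        (Pi.single a 1 + Pi.single s (-(x a / x s))) ∈ structuralMatrixAlgebra ρ hρ := by
      refine vecMulVec_mem fun k m hk hm => ?_
      have h1 := hsup _ _ _ hk
      have h2 := hsup _ _ _ hm
      apply rel <;> grind
    have hwz : (Pi.single a 1 + Pi.single s (-(x a / x s)) : Fin n → ℂ) ⬝ᵥ
        (Pi.single a 1 + Pi.single t (-(y a / y t))) = 1 := by
      rw [single_add_single_dotProduct]
      simp [hta.symm, hsa, hst]
    refine hφ.mulVec_eq_zero_of_map_eq hxy hm hyx hwz ?_ ?_ ?_
    · rw [dotProduct_single_add_single]; field_simp; ring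
    · rw [single_add_single_dotProduct]; field_simp; ring
    · refine hφ.map_vecMulVec_of_overlap hf hm hwz (i := a) ?_ ?_ ?_
      · simp [hta.symm]
      · simp [hsa.symm]
      · intro k hk
        by_cases hkt : k = t
        · right
          have : k ≠ s := by rintro rfl; exact hst hkt
          simp [hk, this]
        · left
          simp [hk, hkt]
  constructor
  · have h := congrFun (key i c hai.symm hac.symm hci.symm (Or.inl rfl) (Or.inr rfl) hx hyc).2 l
    simp only [add_vecMul, single_vecMul, Pi.add_apply, Pi.zero_apply,
      Pi.smul_apply, row_apply, smul_eq_mul, one_mul] at h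
    field_simp at h
    linear_combination h
  · have h := congrFun (key c i hac.symm hai.symm hci (Or.inr rfl) (Or.inl rfl) hxc hy).1 l
    simp only [mulVec_add, mulVec_single, Pi.add_apply, Pi.zero_apply,
      Pi.smul_apply, col_apply, MulOpposite.smul_eq_mul_unop,
      MulOpposite.unop_op, mul_one] at h
    field_simp at h
    linear_combination h

/-- Every `e_k + α e_i + β e_j` orthogonal to `y` is annihilated by the image, since its product
with `e_kᵀ` is a fixed idempotent. The difference of two such vectors is `y j e_i - y i e_j`. -/
lemma Normalized.col_proportional_of_third (hφ : Normalized hρ φ) (hf : FixesColIdem ρ φ)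
    {x y : Fin n → ℂ} (hxy : vecMulVec x y ∈ structuralMatrixAlgebra ρ hρ) (hyx : y ⬝ᵥ x = 1)
    {i j k : Fin n} (hki : k ≠ i) (hkj : k ≠ j) (hij : i ≠ j) (hy : y i ≠ 0)
    (hik : ρ i k) (hjk : ρ j k) (hxk : x k = 0) (l : Fin n) :
    φ (vecMulVec x y) l j * y i = y j * φ (vecMulVec x y) l i := by
  have key : ∀ α β : ℂ, y k + α * y i + β * y j = 0 →
      φ (vecMulVec x y) *ᵥ (Pi.single k 1 + Pi.single i α + Pi.single j β) = 0 := by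
    intro α β h
    have hm : vecMulVec (Pi.single k 1 + Pi.single i α + Pi.single j β) (Pi.single k 1) ∈
        structuralMatrixAlgebra ρ hρ := by
      refine vecMulVec_mem fun s t hs ht => ?_
      have ht' : t = k := by
        by_contra h
        simp [h] at ht
      subst ht'
      by_contra hc
      have h1 : s ≠ i := by rintro rfl; exact hc hik
      have h2 : s ≠ j := by rintro rfl; exact hc hjk
      have h3 : s ≠ t := by rintro rfl; exact hc (hρ.refl _)
      simp [h1, h2, h3] at hs
    have hwz : (Pi.single k 1 : Fin n → ℂ) ⬝ᵥ (Pi.single k 1 + Pi.single i α + Pi.single j β) = 1 := by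
      simp [hki, hkj]
    refine (hφ.mulVec_eq_zero_of_map_eq hxy hm hyx hwz ?_ (by simp [hxk])
      (hφ.map_vecMulVec_of_overlap hf hm hwz (i := k) ?_ (by simp) ?_)).1
    · rw [dotProduct_add, dotProduct_add, dotProduct_single, dotProduct_single, dotProduct_single]
      linear_combination h
    · simp [hki, hkj]
    · intro s hs
      right
      simp [hs]
  have e1 := congrFun (key (-(y k / y i)) 0 (by field_simp; ring)) l
  have e2 := congrFun (key (-(y k / y i) + y j) (-y i) (by field_simp; ring)) l
  simp only [mulVec_add, mulVec_single, Pi.add_apply, Pi.zero_apply,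
    Pi.smul_apply, col_apply, MulOpposite.smul_eq_mul_unop,
    MulOpposite.unop_op, mul_one] at e1 e2
  linear_combination e1 - e2

lemma Normalized.row_proportional_of_third (hφ : Normalized hρ φ) (hf : FixesColIdem ρ φ)
    {x y : Fin n → ℂ} (hxy : vecMulVec x y ∈ structuralMatrixAlgebra ρ hρ) (hyx : y ⬝ᵥ x = 1)
    {i j k : Fin n} (hki : k ≠ i) (hkj : k ≠ j) (hij : i ≠ j) (hx : x i ≠ 0)
    (hik : ρ k i) (hjk : ρ k j) (hyk : y k = 0) (l : Fin n) :
    φ (vecMulVec x y) j l * x i = x j * φ (vecMulVec x y) i l := by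
  have key : ∀ α β : ℂ, x k + α * x i + β * x j = 0 →
      (Pi.single k 1 + Pi.single i α + Pi.single j β) ᵥ* φ (vecMulVec x y) = 0 := by
    intro α β h
    have hm : vecMulVec (Pi.single k 1) (Pi.single k 1 + Pi.single i α + Pi.single j β) ∈
        structuralMatrixAlgebra ρ hρ := by
      refine vecMulVec_mem fun t s ht hs => ?_
      have ht' : t = k := by
        by_contra h
        simp [h] at ht
      subst ht'
      by_contra hc
      have h1 : s ≠ i := by rintro rfl; exact hc hik
      have h2 : s ≠ j := by rintro rfl; exact hc hjk
      have h3 : s ≠ t := by rintro rfl; exact hc (hρ.refl _)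
      simp [h1, h2, h3] at hs
    have hwz : (Pi.single k 1 + Pi.single i α + Pi.single j β) ⬝ᵥ (Pi.single k 1 : Fin n → ℂ) = 1 := by
      simp [hki, hkj]
    refine (hφ.mulVec_eq_zero_of_map_eq hxy hm hyx hwz (by simp [hyk]) ?_
      (hφ.map_vecMulVec_of_overlap hf hm hwz (i := k) (by simp) ?_ ?_)).2
    · rw [add_dotProduct, add_dotProduct, single_dotProduct, single_dotProduct, single_dotProduct]
      linear_combination h
    · simp [hki, hkj]
    · intro s hs
      left
      simp [hs]
  have e1 := congrFun (key (-(x k / x i)) 0 (by field_simp; ring)) l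
  have e2 := congrFun (key (-(x k / x i) + x j) (-x i) (by field_simp; ring)) l
  simp only [add_vecMul, single_vecMul, Pi.add_apply, Pi.zero_apply,
    Pi.smul_apply, row_apply, smul_eq_mul] at e1 e2
  linear_combination e1 - e2

/-- The supports of `x` and `y` have exactly the two indices `i`, `j` in common, and a third index
is comparable with both. -/
lemma Normalized.proportional_of_two (hφ : Normalized hρ φ) (hf : FixesColIdem ρ φ)
    {x y : Fin n → ℂ} (hxy : vecMulVec x y ∈ structuralMatrixAlgebra ρ hρ) (hyx : y ⬝ᵥ x = 1)
    {i j k : Fin n} (hki : k ≠ i) (hkj : k ≠ j) (hij : i ≠ j) (hx : x i ≠ 0) (hy : y i ≠ 0)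
    (hxj : x j ≠ 0) (hyj : y j ≠ 0) (h0 : ∀ l, l ≠ i → l ≠ j → x l = 0 ∨ y l = 0)
    (hk : (ρ i k ∧ x k = 0) ∨ (ρ k i ∧ y k = 0)) (l : Fin n) :
    φ (vecMulVec x y) j l * x i = x j * φ (vecMulVec x y) i l ∧
      φ (vecMulVec x y) l j * y i = y j * φ (vecMulVec x y) l i := by
  -- The idempotent `z wᵀ` is orthogonal to `x yᵀ` in the `{i, j}` block. Its image `B` is not yet
  -- known, but the third index controls its columns or its rows.
  set z : Fin n → ℂ := Pi.single i (y j) + Pi.single j (-y i) with hz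
  set w : Fin n → ℂ := Pi.single i (x j) + Pi.single j (-x i) with hw
  have zi : z i = y j := by simp [hz, hij]
  have zj : z j = -y i := by simp [hz, hij.symm]
  have wi : w i = x j := by simp [hw, hij]
  have wj : w j = -x i := by simp [hw, hij.symm]
  have zl : ∀ l, l ≠ i → l ≠ j → z l = 0 := fun l h1 h2 => by simp [hz, h1, h2]
  have wl : ∀ l, l ≠ i → l ≠ j → w l = 0 := fun l h1 h2 => by simp [hw, h1, h2]
  have rij := rel_of_mem hxy hx hyj
  have rji := rel_of_mem hxy hxj hy
  have hm : vecMulVec z w ∈ structuralMatrixAlgebra ρ hρ := by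
    refine vecMulVec_mem fun s t hs ht => ?_
    have h1 : s = i ∨ s = j := by by_contra! hc; exact hs (zl s hc.1 hc.2)
    have h2 : t = i ∨ t = j := by by_contra! hc; exact ht (wl t hc.1 hc.2)
    rcases h1 with rfl | rfl <;> rcases h2 with rfl | rfl <;> first | exact hρ.refl _ | assumption
  have hwz : w ⬝ᵥ z = 1 := by
    rw [dotProduct, Fintype.sum_eq_add i j hij] at hyx ⊢
    · rw [zi, zj, wi, wj]; linear_combination hyx
    · rintro s ⟨h1, h2⟩; rw [zl s h1 h2, mul_zero]
    · rintro s ⟨h1, h2⟩; rcases h0 s h1 h2 with h | h <;> simp [h]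
  have hyz : y ⬝ᵥ z = 0 := by rw [hz, dotProduct_single_add_single]; ring
  have hwx : w ⬝ᵥ x = 0 := by rw [hw, single_add_single_dotProduct]; ring
  have ho := hφ.map_vecMulVec_orthogonal hxy hm hyx hwz hyz hwx
  set A := φ (vecMulVec x y) with hA
  set B := φ (vecMulVec z w) with hB
  have B0 : ∀ s, s ≠ i → s ≠ j → ∀ t, B s t = 0 ∧ B t s = 0 := fun s h1 h2 t =>
    hφ.map_vecMulVec_apply_eq_zero hm hwz (zl s h1 h2) (wl s h1 h2) t
  have Bne : B ≠ 0 := by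
    refine hφ.map_ne_zero (diagonal_mem hρ) hm ?_
    rw [Ne, vecMulVec_eq_zero]
    rintro (h | h) <;> simp [h] at hwz
  have hwi : w i ≠ 0 := by rw [wi]; exact hxj
  have hzi : z i ≠ 0 := by rw [zi]; exact hyj
  rcases hk with ⟨hr, hk⟩ | ⟨hr, hk⟩
  · have hr' := hρ.trans j i k rji hr
    have cA := hφ.col_proportional_of_third hf hxy hyx hki hkj hij hy hr hr' hk
    -- The third index gives only column relations here; the row relation for `A` follows from `B *
    -- A = 0` and the column relation for `B`.
    have cB := hφ.col_proportional_of_third hf hm hwz hki hkj hij hwi hr hr' (zl k hki hkj)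
    refine ⟨?_, cA l⟩
    obtain ⟨s, hs⟩ : ∃ s, B s i ≠ 0 := by
      by_contra! hc
      apply Bne
      ext s t
      rw [Matrix.zero_apply]
      by_cases hti : t = i
      · rw [hti, hc]
      by_cases htj : t = j
      · have := cB s
        rw [← hB, hc, mul_zero, mul_eq_zero] at this
        rw [htj]
        exact this.resolve_right hwi
      · exact (B0 t hti htj s).2
    have h1 := congrFun (congrFun ho.2 s) l
    rw [mul_apply, Fintype.sum_eq_add i j hij, Matrix.zero_apply] at h1
    · have h2 := cB s
      rw [← hB, wi, wj] at h2
      apply mul_left_cancel₀ hs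
      linear_combination A j l * h2 - x j * h1
    · rintro t ⟨h2, h3⟩
      rw [(B0 t h2 h3 s).2, zero_mul]
  · have hr' := hρ.trans k i j hr rij
    have cA := hφ.row_proportional_of_third hf hxy hyx hki hkj hij hx hr hr' hk
    have cB := hφ.row_proportional_of_third hf hm hwz hki hkj hij hzi hr hr' (wl k hki hkj)
    refine ⟨cA l, ?_⟩
    obtain ⟨s, hs⟩ : ∃ s, B i s ≠ 0 := by
      by_contra! hc
      apply Bne
      ext t s
      rw [Matrix.zero_apply]
      by_cases hti : t = i
      · rw [hti, hc]
      by_cases htj : t = j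
      · have := cB s
        rw [← hB, hc, mul_zero, mul_eq_zero] at this
        rw [htj]
        exact this.resolve_right hzi
      · exact (B0 t hti htj s).1
    have h1 := congrFun (congrFun ho.1 l) s
    rw [mul_apply, Fintype.sum_eq_add i j hij, Matrix.zero_apply] at h1
    · have h2 := cB s
      rw [← hB, zi, zj] at h2
      apply mul_left_cancel₀ hs
      linear_combination A l j * h2 - y j * h1
    · rintro t ⟨h2, h3⟩
      rw [(B0 t h2 h3 s).1, mul_zero]

lemma Normalized.map_vecMulVec (hφ : Normalized hρ φ) (h3 : ThreeCommonNeighbours ρ)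
    (hf : FixesColIdem ρ φ) {x y : Fin n → ℂ}
    (hxy : vecMulVec x y ∈ structuralMatrixAlgebra ρ hρ) (hyx : y ⬝ᵥ x = 1) :
    φ (vecMulVec x y) = vecMulVec x y := by
  obtain ⟨i, hi⟩ : ∃ i, y i * x i ≠ 0 := by
    by_contra! hc
    simp [dotProduct, hc] at hyx
  have hx := right_ne_zero_of_mul hi
  have hy := left_ne_zero_of_mul hi
  by_cases hone : ∀ k, k ≠ i → x k = 0 ∨ y k = 0
  · exact hφ.map_vecMulVec_of_overlap hf hxy hyx hx hy hone
  push Not at hone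
  obtain ⟨j, hji, hxj, hyj⟩ := hone
  refine hφ.map_vecMulVec_of_proportional hxy hyx hx hy fun k l => ?_
  by_cases hk : x k = 0 ∨ y k = 0
  · exact hφ.proportional_of_eq_zero hf hxy hyx hx hy hk l
  by_cases hki : k = i
  · subst hki; exact ⟨mul_comm _ _, mul_comm _ _⟩
  push Not at hk
  by_cases htwo : ∀ c, c ≠ i → c ≠ k → x c = 0 ∨ y c = 0
  · have rik := rel_of_mem hxy hx hk.2
    have rki := rel_of_mem hxy hk.1 hy
    obtain ⟨c, hci, hck, hc⟩ := h3.exists_third hρ rik (Ne.symm hki)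
    refine hφ.proportional_of_two hf hxy hyx hci hck (Ne.symm hki) hx hy hk.1 hk.2 htwo ?_ l
    -- A nonzero `x c` or `y c` itself gives a relation between `c` and `i`, so some side always has
    -- both the relation and the zero entry.
    have h1 : x c ≠ 0 → ρ c i := fun h => rel_of_mem hxy h hy
    have h2 : y c ≠ 0 → ρ i c := fun h => rel_of_mem hxy hx h
    have h4 := htwo c hci hck
    tauto
  · push Not at htwo
    obtain ⟨c, hci, hck, hxc, hyc⟩ := htwo
    exact hφ.proportional_of_three hf hxy hyx hki (Ne.symm hck) hci hx hy hk.1 hk.2 hxc hyc l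

lemma conjDiag_single (V : (Matrix (Fin n) (Fin n) ℂ)ˣ) (k : Fin n) :
    conjDiag V (Pi.single k 1) = vecMulVec (fun i => V.val i k) (fun j => V⁻¹.val k j) := by
  ext i j
  rw [conjDiag, mul_apply, Fintype.sum_eq_single k]
  · rw [mul_diagonal, vecMulVec_apply]; simp
  · intro s hs
    rw [mul_diagonal]; simp [hs]

lemma Normalized.eq_id (hφ : Normalized hρ φ) (h3 : ThreeCommonNeighbours ρ)
    (hf : FixesColIdem ρ φ) {X : Matrix (Fin n) (Fin n) ℂ}
    (hX : X ∈ structuralMatrixAlgebra ρ hρ) : φ X = X := by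
  have h1 : Set.EqOn φ id (structuralMatrixAlgebra ρ hρ) := by
    refine Set.EqOn.of_subset_closure
      (s := {X | X ∈ structuralMatrixAlgebra ρ hρ ∧ HasSimpleSpectrum X}) ?_ hφ.cont
      continuousOn_id (fun Y hY => hY.1) (subset_closure_hasSimpleSpectrum _ (diagonal_mem hρ))
    rintro Y ⟨hY, hs⟩
    obtain ⟨V, V', d, hd, e1, e2⟩ := hφ.exists_conjDiag hY hs
    rw [e1] at e2
    -- The spectral projections of `Y` are rank-one idempotents of the algebra, so they are fixed
    -- and agree with those of `φ Y`.
    have key : ∀ k, conjDiag V (Pi.single k 1) = conjDiag V' (Pi.single k 1) := by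
      intro k
      obtain ⟨m, e⟩ := hφ.map_conjDiag hd (e1 ▸ hY) e2 (Pi.single k 1)
      rw [← e]
      rw [conjDiag_single] at m ⊢
      refine (hφ.map_vecMulVec h3 hf m ?_).symm
      have := congrFun (congrFun V.inv_mul k) k
      rw [mul_apply, one_apply_eq] at this
      exact this
    have lin : ∀ W : (Matrix (Fin n) (Fin n) ℂ)ˣ,
        conjDiag W d = ∑ k, d k • conjDiag W (Pi.single k 1) := by
      intro W
      ext i j
      rw [Matrix.sum_apply, conjDiag, mul_apply]
      refine Finset.sum_congr rfl fun k _ => ?_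
      rw [Matrix.smul_apply, conjDiag_single, vecMulVec_apply, mul_diagonal, smul_eq_mul]
      ring
    rw [e1, e2, id, lin V, lin V']
    simp only [key]
  exact h1 hX

end RankOne

/-! ### Assembling the representation. -/

section Representation

variable {n : ℕ} {ρ : Fin n → Fin n → Prop} {hρ : IsQuasiOrder ρ}

/-- Diagonalising the image of one diagonal matrix with distinct entries supplies `S`;
`PreservesOn.map_conjDiag` then handles all diagonal matrices at once. -/
lemma PreservesOn.exists_normalized {φ : Matrix (Fin n) (Fin n) ℂ → Matrix (Fin n) (Fin n) ℂ}
    (hφ : PreservesOn (structuralMatrixAlgebra ρ hρ) φ) :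
    ∃ S : (Matrix (Fin n) (Fin n) ℂ)ˣ, Normalized hρ fun X => S⁻¹.val * φ X * S.val := by
  set d : Fin n → ℂ := fun i => ((i : ℕ) : ℂ)
  have hd : Function.Injective d := fun i j h => Fin.ext (Nat.cast_injective h)
  have h1 : ∀ μ : Fin n → ℂ, conjDiag 1 μ = diagonal μ := fun μ => by simp [conjDiag]
  have hm : conjDiag 1 d ∈ structuralMatrixAlgebra ρ hρ := by rw [h1]; exact diagonal_mem hρ d
  obtain ⟨S, hS⟩ := exists_eq_conjDiag (φ (conjDiag 1 d)) d hd fun i => by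
    rw [hφ.spec _ hm, spectrum_conjDiag]
    exact ⟨i, rfl⟩
  have hinj : ∀ Y Z : Matrix (Fin n) (Fin n) ℂ,
      S⁻¹.val * Y * S.val = S⁻¹.val * Z * S.val → Y = Z := by
    intro Y Z h
    have h2 := congrArg (fun W => S.val * W * S⁻¹.val) h
    simpa [mul_assoc] using h2
  refine ⟨S, ⟨⟨?_, ?_, ?_, ?_⟩, ?_⟩⟩
  · exact fun X hX Y hY h => hφ.inj hX hY (hinj _ _ h)
  · exact (continuousOn_const.mul hφ.cont).mul continuousOn_const
  · intro X hX Y hY h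
    have h2 := (hφ.comm X hX Y hY h).eq
    simp only [Commute, SemiconjBy, mul_assoc, Units.mul_inv_cancel_left]
    rw [← mul_assoc (φ X), h2, mul_assoc]
  · intro X hX
    rw [spectrum.units_conjugate', hφ.spec X hX]
  · intro μ
    have h2 := (hφ.map_conjDiag hd hm hS μ).2
    rw [h1] at h2
    rw [h2]
    simp [conjDiag, mul_assoc]

lemma Normalized.exists_eq_inducedAut {φ : Matrix (Fin n) (Fin n) ℂ → Matrix (Fin n) (Fin n) ℂ}
    (hφ : Normalized hρ φ) (h3 : ThreeCommonNeighbours ρ)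
    (hp : ∀ i j, ρ i j → i ≠ j → IsPlain φ i j) :
    ∃ (g : Fin n → Fin n → ℂˣ) (hg : IsTransitiveMap ρ g),
      ∀ X : structuralMatrixAlgebra ρ hρ, φ X = inducedAut hρ hg X := by
  obtain ⟨g, hg, hgc⟩ := hφ.exists_isTransitiveMap h3 hp
  refine ⟨g, hg, fun X => ?_⟩
  have hf : FixesColIdem ρ fun X => φ (entrywiseDiv g X) := by
    intro i j h hij a
    obtain ⟨b, rfl⟩ : ∃ b, a = g i j * b := ⟨(g i j)⁻¹.val * a, by simp⟩
    simp only [entrywiseDiv_colIdem hg hρ]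
    exact hgc i j h hij b
  have h1 := (hφ.comp_entrywiseDiv hg).eq_id h3 hf (inducedAut hρ hg X).2
  simpa only [entrywiseDiv_eq_symm hg, AlgEquiv.symm_apply_apply] using h1

lemma PreservesOn.exists_representation
    {φ : Matrix (Fin n) (Fin n) ℂ → Matrix (Fin n) (Fin n) ℂ}
    (hφ : PreservesOn (structuralMatrixAlgebra ρ hρ) φ) (h3 : ThreeCommonNeighbours ρ) :
    ∃ (S : (Matrix (Fin n) (Fin n) ℂ)ˣ) (g : Fin n → Fin n → ℂˣ) (hg : IsTransitiveMap ρ g)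
      (p : Fin n → ℂ), (∀ i, p i = 0 ∨ p i = 1) ∧ (∀ i j, ρ i j → p i = p j) ∧
      ∀ X : structuralMatrixAlgebra ρ hρ,
        φ X = S.val * partialTranspose (diagonal p) (inducedAut hρ hg X).val * S⁻¹.val := by
  obtain ⟨S, hS⟩ := hφ.exists_normalized
  obtain ⟨p, hp, hp', hpl⟩ := hS.exists_partialTranspose_isPlain h3
  obtain ⟨g, hg, hT⟩ := (hS.partialTranspose hp hp').exists_eq_inducedAut h3 hpl
  refine ⟨S, g, hg, p, hp, hp', fun X => ?_⟩
  have hc : Commute (diagonal p) (S⁻¹.val * φ X * S.val) := by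
    have h1 := hS.comm _ (diagonal_mem hρ p) X X.2 (commute_diagonal_of_mem hp' X.2)
    rwa [hS.diag] at h1
  rw [← hT, partialTranspose_partialTranspose (isIdempotentElem_diagonal hp)
    (diagonal_transpose p) hc]
  simp only [mul_assoc, Units.mul_inv_cancel_left, Units.mul_inv, mul_one]

lemma IsPreserver.exists_representation
    {φ : structuralMatrixAlgebra ρ hρ → Matrix (Fin n) (Fin n) ℂ} (hφ : IsPreserver φ)
    (h3 : ThreeCommonNeighbours ρ) :
    ∃ (S : (Matrix (Fin n) (Fin n) ℂ)ˣ) (g : Fin n → Fin n → ℂˣ) (hg : IsTransitiveMap ρ g)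
      (p : Fin n → ℂ), (∀ i, p i = 0 ∨ p i = 1) ∧ (∀ i j, ρ i j → p i = p j) ∧
      ∀ X : structuralMatrixAlgebra ρ hρ,
        φ X = S.val * partialTranspose (diagonal p) (inducedAut hρ hg X).val * S⁻¹.val := by
  classical
  set Φ : Matrix (Fin n) (Fin n) ℂ → Matrix (Fin n) (Fin n) ℂ := fun X =>
    if h : X ∈ structuralMatrixAlgebra ρ hρ then φ ⟨X, h⟩ else 0 with hΦ
  have hval : ∀ X : structuralMatrixAlgebra ρ hρ, Φ X = φ X := fun X => by simp [hΦ]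
  have hP : PreservesOn (structuralMatrixAlgebra ρ hρ) Φ := by
    refine ⟨fun X hX Y hY h => ?_, ?_, fun X hX Y hY h => ?_, fun X hX => ?_⟩
    · rw [hval ⟨X, hX⟩, hval ⟨Y, hY⟩] at h
      exact congrArg Subtype.val (hφ.injective h)
    · rw [continuousOn_iff_continuous_domRestrict]
      exact hφ.continuous.congr fun X => (hval X).symm
    · rw [hval ⟨X, hX⟩, hval ⟨Y, hY⟩]
      exact hφ.commute _ _ (Subtype.ext h.eq)
    · rw [hval ⟨X, hX⟩]
      exact hφ.spectrum_eq _
  obtain ⟨S, g, hg, p, h1, h2, h4⟩ := hP.exists_representation h3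
  exact ⟨S, g, hg, p, h1, h2, fun X => by rw [← hval, h4]⟩

lemma isJordanEmbedding_of_representation
    {φ : structuralMatrixAlgebra ρ hρ → Matrix (Fin n) (Fin n) ℂ} (hinj : Function.Injective φ)
    (S : (Matrix (Fin n) (Fin n) ℂ)ˣ) {g : Fin n → Fin n → ℂˣ} (hg : IsTransitiveMap ρ g)
    {p : Fin n → ℂ} (hp : ∀ i, p i = 0 ∨ p i = 1) (hp' : ∀ i j, ρ i j → p i = p j)
    (h : ∀ X : structuralMatrixAlgebra ρ hρ,
      φ X = S.val * partialTranspose (diagonal p) (inducedAut hρ hg X).val * S⁻¹.val) :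
    IsJordanEmbedding φ := by
  refine ⟨⟨fun X Y => ?_, fun c X => ?_⟩, hinj, fun X Y => ?_⟩
  · simp only [h, partialTranspose, map_add, Subalgebra.coe_add, transpose_add]
    noncomm_ring
  · simp only [h, partialTranspose, map_smul, Subalgebra.coe_smul, transpose_smul,
      mul_smul_comm, smul_mul_assoc, ← smul_add]
  · have key := fun X Y : structuralMatrixAlgebra ρ hρ =>
      partialTranspose_mul (isIdempotentElem_diagonal hp) (diagonal_transpose p)
        (commute_diagonal_of_mem hp' (inducedAut hρ hg X).2) (inducedAut hρ hg Y).val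
    have hmul : ∀ A B : Matrix (Fin n) (Fin n) ℂ,
        S.val * A * S⁻¹.val * (S.val * B * S⁻¹.val) = S.val * (A * B) * S⁻¹.val := by
      intro A B
      simp [mul_assoc]
    simp only [h, hmul, key]
    simp only [partialTranspose, map_add, map_mul, Subalgebra.coe_add, Subalgebra.coe_mul,
      transpose_add]
    noncomm_ring

lemma diagonal_mem_center {p : Fin n → ℂ} (hp : ∀ i j, ρ i j → p i = p j) :
    (⟨diagonal p, diagonal_mem hρ p⟩ : structuralMatrixAlgebra ρ hρ) ∈
      Subalgebra.center ℂ (structuralMatrixAlgebra ρ hρ) := by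
  rw [Subalgebra.mem_center_iff]
  intro X
  exact Subtype.ext (commute_diagonal_of_mem hp X.2).eq.symm

end Representation

/-! ### A nonlinear preserver when there is no third common neighbour. -/

section Nonlinear

variable {n : ℕ}

/-- The weight `1 + |p| / (|p| + |q| + |r|)` of a `2 × 2` block with diagonal difference `p` and
off-diagonal entries `q`, `r`. -/
noncomputable def weight (p q r : ℂ) : ℝ := 1 + ‖p‖ / (‖p‖ + ‖q‖ + ‖r‖)

lemma one_le_weight (p q r : ℂ) : 1 ≤ weight p q r := by
  unfold weight
  have : 0 ≤ ‖p‖ / (‖p‖ + ‖q‖ + ‖r‖) := by positivity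
  linarith

lemma weight_le_two (p q r : ℂ) : weight p q r ≤ 2 := by
  unfold weight
  have : ‖p‖ / (‖p‖ + ‖q‖ + ‖r‖) ≤ 1 :=
    div_le_one_of_le₀ (by linarith [norm_nonneg q, norm_nonneg r]) (by positivity)
  linarith

lemma weight_sub_one_mul (p q r : ℂ) : (weight p q r - 1) * (‖p‖ + ‖q‖ + ‖r‖) = ‖p‖ := by
  unfold weight
  by_cases h : ‖p‖ + ‖q‖ + ‖r‖ = 0
  · have : ‖p‖ = 0 := by linarith [norm_nonneg p, norm_nonneg q, norm_nonneg r]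
    simp [this]
  · field_simp
    ring

/-- For given moduli of `w q` and `w⁻¹ r`, the quantity `(w - 1) (‖p‖ + ‖q‖ + ‖r‖)` is strictly
increasing in `w` when `p ≠ 0`. It must equal `‖p‖`, so the weight is determined by the image. -/
lemma weight_injective {p q r q' r' : ℂ} (hq : weight p q r * q = weight p q' r' * q')
    (hr : ((weight p q r : ℂ))⁻¹ * r = ((weight p q' r' : ℂ))⁻¹ * r') : q = q' ∧ r = r' := by
  have key : ∀ q r q' r' : ℂ, (weight p q r : ℂ) * q = weight p q' r' * q' →
      ((weight p q r : ℂ))⁻¹ * r = ((weight p q' r' : ℂ))⁻¹ * r' →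
      ¬ weight p q r < weight p q' r' := by
    intro q r q' r' hq hr hlt
    have e1 := weight_sub_one_mul p q r
    have e2 := weight_sub_one_mul p q' r'
    have b1 := one_le_weight p q r
    have hp : 0 < ‖p‖ := by
      rw [norm_pos_iff]
      rintro rfl
      simp [weight] at hlt
    set u := weight p q r
    set v := weight p q' r'
    have hu : 0 < u := by linarith
    have hv : 0 < v := by linarith
    have n1 : u * ‖q‖ = v * ‖q'‖ := by
      have := congrArg norm hq
      simpa [abs_of_pos hu, abs_of_pos hv] using this
    have n2 : u⁻¹ * ‖r‖ = v⁻¹ * ‖r'‖ := by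
      have := congrArg norm hr
      simpa [abs_of_pos hu, abs_of_pos hv] using this
    have q1 : ‖q'‖ = u * ‖q‖ / v := by rw [n1]; field_simp
    have r1 : ‖r'‖ = v * ‖r‖ / u := by
      have : v * ‖r‖ / u = v * (u⁻¹ * ‖r‖) := by ring
      rw [this, n2]; field_simp
    have s1 : (u - 1) * ‖q‖ ≤ (v - 1) * ‖q'‖ := by
      rw [q1, mul_div_assoc', le_div_iff₀ hv]
      nlinarith [mul_nonneg (norm_nonneg q) (sub_nonneg.2 hlt.le)]
    have s2 : (u - 1) * ‖r‖ ≤ (v - 1) * ‖r'‖ := by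
      have : ‖r‖ ≤ ‖r'‖ := by
        rw [r1, le_div_iff₀ hu]
        nlinarith [norm_nonneg r]
      exact mul_le_mul (by linarith) this (norm_nonneg _) (by linarith)
    have s3 : (u - 1) * ‖p‖ < (v - 1) * ‖p‖ := by
      apply mul_lt_mul_of_pos_right _ hp
      linarith
    nlinarith
  have heq : weight p q r = weight p q' r' :=
    le_antisymm (not_lt.1 (key _ _ _ _ hq.symm hr.symm)) (not_lt.1 (key _ _ _ _ hq hr))
  have h0 : (weight p q' r' : ℂ) ≠ 0 := by
    have := one_le_weight p q' r'
    exact_mod_cast (by linarith : weight p q' r' ≠ 0)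
  rw [heq] at hq hr
  exact ⟨mul_left_cancel₀ h0 hq, mul_left_cancel₀ (inv_ne_zero h0) hr⟩

/-- The weight is homogeneous of degree zero. Only proportions with the first coordinate are needed,
since that coordinate is the numerator. -/
lemma weight_eq_of_parallel {p q r p' q' r' : ℂ} (h1 : p * q' = p' * q) (h2 : p * r' = p' * r) :
    (p = 0 ∧ q = 0 ∧ r = 0) ∨ (p' = 0 ∧ q' = 0 ∧ r' = 0) ∨ weight p q r = weight p' q' r' := by
  by_cases hs : ‖p‖ + ‖q‖ + ‖r‖ = 0
  · left
    refine ⟨?_, ?_, ?_⟩ <;> rw [← norm_eq_zero] <;>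
      linarith [norm_nonneg p, norm_nonneg q, norm_nonneg r]
  by_cases hs' : ‖p'‖ + ‖q'‖ + ‖r'‖ = 0
  · right; left
    refine ⟨?_, ?_, ?_⟩ <;> rw [← norm_eq_zero] <;>
      linarith [norm_nonneg p', norm_nonneg q', norm_nonneg r']
  right; right
  unfold weight
  congr 1
  rw [div_eq_div_iff hs hs']
  have n1 := congrArg norm h1
  have n2 := congrArg norm h2
  rw [norm_mul, norm_mul] at n1 n2
  linear_combination n1 + n2

/-- The weight is discontinuous where a block is scalar, but it is bounded and multiplies an entry
that vanishes there. -/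
lemma continuous_mul_of_bounded {E : Type*} [TopologicalSpace E] {f t : E → ℂ} {s : E → ℝ}
    (ht : Continuous t) (hf : ∀ x, ‖f x‖ ≤ 2)
    (hfc : ∀ x, s x ≠ 0 → ContinuousAt f x) (hts : ∀ x, s x = 0 → t x = 0) :
    Continuous fun x => f x * t x := by
  rw [continuous_iff_continuousAt]
  intro x
  by_cases hx : s x = 0
  · have h0 := hts x hx
    rw [ContinuousAt, h0, mul_zero]
    have h1 : Tendsto (fun y => 2 * ‖t y‖) (𝓝 x) (𝓝 0) := by
      have := (ht.norm.const_mul 2).tendsto x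
      simpa [h0] using this
    refine squeeze_zero_norm (fun y => ?_) h1
    rw [norm_mul]
    exact mul_le_mul_of_nonneg_right (hf y) (norm_nonneg _)
  · exact (hfc x hx).mul ht.continuousAt

/-- The weight of the `{i, j}` block of a matrix. -/
noncomputable def blockWeight (i j : Fin n) (X : Matrix (Fin n) (Fin n) ℂ) : ℝ :=
  weight (X i i - X j j) (X i j) (X j i)

/-- Multiply the entries `(i, j)` and `(j, i)` by the weight of the `{i, j}` block and its
inverse. -/
noncomputable def rescale (i j : Fin n) (X : Matrix (Fin n) (Fin n) ℂ) :
    Matrix (Fin n) (Fin n) ℂ :=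
  Matrix.of fun k l => if k = i ∧ l = j then (blockWeight i j X : ℂ) * X i j else
    if k = j ∧ l = i then (blockWeight i j X : ℂ)⁻¹ * X j i else X k l

lemma blockWeight_ne_zero (i j : Fin n) (X : Matrix (Fin n) (Fin n) ℂ) :
    (blockWeight i j X : ℂ) ≠ 0 := by
  have := one_le_weight (X i i - X j j) (X i j) (X j i)
  unfold blockWeight
  exact_mod_cast (by linarith : weight (X i i - X j j) (X i j) (X j i) ≠ 0)

lemma rescale_apply_of_not {i j k l : Fin n} (X : Matrix (Fin n) (Fin n) ℂ)
    (h1 : ¬ (k = i ∧ l = j)) (h2 : ¬ (k = j ∧ l = i)) : rescale i j X k l = X k l := by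
  simp [rescale, h1, h2]

lemma rescale_apply_left {i j : Fin n} (X : Matrix (Fin n) (Fin n) ℂ) :
    rescale i j X i j = blockWeight i j X * X i j := by
  simp [rescale]

lemma rescale_apply_right {i j : Fin n} (hij : i ≠ j) (X : Matrix (Fin n) (Fin n) ℂ) :
    rescale i j X j i = (blockWeight i j X : ℂ)⁻¹ * X j i := by
  simp [rescale, hij, hij.symm]

lemma rescale_apply_eq_zero (i j : Fin n) {X : Matrix (Fin n) (Fin n) ℂ} {k l : Fin n}
    (h : X k l = 0) : rescale i j X k l = 0 := by
  simp only [rescale, of_apply]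
  split_ifs with h1 h2
  · rw [← h1.1, ← h1.2, h, mul_zero]
  · rw [← h2.1, ← h2.2, h, mul_zero]
  · exact h

lemma rescale_diag {i j : Fin n} (hij : i ≠ j) (X : Matrix (Fin n) (Fin n) ℂ) (k : Fin n) :
    rescale i j X k k = X k k := by
  refine rescale_apply_of_not X ?_ ?_ <;> rintro ⟨h1, h2⟩ <;> grind

lemma rescale_injective {i j : Fin n} (hij : i ≠ j) :
    Function.Injective (rescale i j) := by
  intro X Y h
  have e := fun k l => congrFun (congrFun h k) l
  have ei := e i i
  have ej := e j j
  have el := e i j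
  have er := e j i
  rw [rescale_diag hij, rescale_diag hij] at ei ej
  rw [rescale_apply_left, rescale_apply_left] at el
  rw [rescale_apply_right hij, rescale_apply_right hij] at er
  unfold blockWeight at el er
  rw [ei, ej] at el er
  have h1 := weight_injective el er
  ext k l
  by_cases hl : k = i ∧ l = j
  · rw [hl.1, hl.2, h1.1]
  by_cases hr : k = j ∧ l = i
  · rw [hr.1, hr.2, h1.2]
  have := e k l
  rwa [rescale_apply_of_not X hl hr, rescale_apply_of_not Y hl hr] at this

lemma continuous_rescale {i j : Fin n} (hij : i ≠ j) : Continuous (rescale i j) := by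
  set s : Matrix (Fin n) (Fin n) ℂ → ℝ := fun X => ‖X i i - X j j‖ + ‖X i j‖ + ‖X j i‖ with hs
  have hs0 : ∀ X, s X = 0 → X i j = 0 ∧ X j i = 0 := by
    intro X h
    simp only [hs] at h
    have h1 := norm_nonneg (X i i - X j j)
    have h2 := norm_nonneg (X i j)
    have h3 := norm_nonneg (X j i)
    constructor <;> rw [← norm_eq_zero] <;> linarith
  have hw : ∀ X, s X ≠ 0 → ContinuousAt (fun X => (blockWeight i j X : ℂ)) X := by
    intro X hX
    unfold blockWeight weight
    refine Complex.continuous_ofReal.continuousAt.comp (continuousAt_const.add ?_)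
    refine ContinuousAt.div ?_ ?_ hX <;> fun_prop
  have b1 : ∀ X, 1 ≤ blockWeight i j X := fun X => one_le_weight _ _ _
  have b2 : ∀ X, blockWeight i j X ≤ 2 := fun X => weight_le_two _ _ _
  refine continuous_matrix fun k l => ?_
  by_cases hl : k = i ∧ l = j
  · rw [hl.1, hl.2]
    simp only [rescale_apply_left]
    refine continuous_mul_of_bounded (s := s) (by fun_prop) (fun X => ?_) hw fun X h => (hs0 X h).1
    rw [Complex.norm_real, Real.norm_of_nonneg (by linarith [b1 X])]
    exact b2 X
  by_cases hr : k = j ∧ l = i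
  · rw [hr.1, hr.2]
    simp only [rescale_apply_right hij]
    refine continuous_mul_of_bounded (s := s) (by fun_prop) (fun X => ?_)
      (fun X h => (hw X h).inv₀ (blockWeight_ne_zero i j X)) fun X h => (hs0 X h).2
    rw [norm_inv, Complex.norm_real, Real.norm_of_nonneg (by linarith [b1 X])]
    exact (inv_le_one_of_one_le₀ (b1 X)).trans (by norm_num)
  · simp only [rescale_apply_of_not _ hl hr]
    fun_prop

variable {ρ : Fin n → Fin n → Prop} {hρ : IsQuasiOrder ρ}

lemma commute_rescale {i j : Fin n} (hij : i ≠ j) (h : ρ i j)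
    (hcom : ∀ k, k ≠ i → k ≠ j → ¬ ((ρ i k ∨ ρ k i) ∧ (ρ j k ∨ ρ k j)))
    {X Y : Matrix (Fin n) (Fin n) ℂ} (hX : X ∈ structuralMatrixAlgebra ρ hρ)
    (hY : Y ∈ structuralMatrixAlgebra ρ hρ) (hXY : X * Y = Y * X) :
    rescale i j X * rescale i j Y = rescale i j Y * rescale i j X := by
  -- A rescaled entry contributing outside the block would produce a third index comparable with
  -- both `i` and `j`.
  have out : ∀ {X Y : Matrix (Fin n) (Fin n) ℂ}, X ∈ structuralMatrixAlgebra ρ hρ →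
      Y ∈ structuralMatrixAlgebra ρ hρ → ∀ k l, ¬ ((k = i ∨ k = j) ∧ (l = i ∨ l = j)) →
      (rescale i j X * rescale i j Y) k l = (X * Y) k l := by
    intro X Y hX hY k l hkl
    rw [mul_apply, mul_apply]
    refine Finset.sum_congr rfl fun m _ => ?_
    by_cases hx : X k m = 0
    · rw [hx, rescale_apply_eq_zero i j hx, zero_mul, zero_mul]
    by_cases hy : Y m l = 0
    · rw [hy, rescale_apply_eq_zero i j hy, mul_zero, mul_zero]
    have h1 := hX k m hx
    have h2 := hY m l hy
    have h3 := hρ.trans k m l h1 h2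
    have c1 := hcom k
    have c2 := hcom l
    rw [rescale_apply_of_not, rescale_apply_of_not] <;> rintro ⟨rfl, rfl⟩ <;> tauto
  have inn : ∀ {X Y : Matrix (Fin n) (Fin n) ℂ}, X ∈ structuralMatrixAlgebra ρ hρ →
      Y ∈ structuralMatrixAlgebra ρ hρ → ∀ k l, (k = i ∨ k = j) → (l = i ∨ l = j) →
      (X * Y) k l = X k i * Y i l + X k j * Y j l := by
    intro X Y hX hY k l hk hl
    rw [mul_apply, Fintype.sum_eq_add i j hij]
    rintro m ⟨hmi, hmj⟩
    by_contra h0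
    have h1 := hX k m (left_ne_zero_of_mul h0)
    have h2 := hY m l (right_ne_zero_of_mul h0)
    have h3 := hρ.trans i j m h
    have h4 := fun h' => hρ.trans m i j h' h
    have c := hcom m hmi hmj
    rcases hk with rfl | rfl <;> rcases hl with rfl | rfl <;> tauto
  have mem : ∀ {X : Matrix (Fin n) (Fin n) ℂ}, X ∈ structuralMatrixAlgebra ρ hρ →
      rescale i j X ∈ structuralMatrixAlgebra ρ hρ := by
    intro X hX k l hkl
    simp only [rescale, of_apply] at hkl
    split_ifs at hkl with h1 h2
    · rw [h1.1, h1.2]; exact h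
    · rw [h2.1, h2.2]; exact hX j i (right_ne_zero_of_mul hkl)
    · exact hX k l hkl
  have e := fun k l (hk : k = i ∨ k = j) (hl : l = i ∨ l = j) => by
    have := congrFun (congrFun hXY k) l
    rwa [inn hX hY k l hk hl, inn hY hX k l hk hl] at this
  have eii := e i i (Or.inl rfl) (Or.inl rfl)
  have eij := e i j (Or.inl rfl) (Or.inr rfl)
  have eji := e j i (Or.inr rfl) (Or.inl rfl)
  -- The off-diagonal entries of the commutator in the block are exactly the two parallelism
  -- relations.
  have hw := weight_eq_of_parallel (p := X i i - X j j) (q := X i j) (r := X j i)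
    (p' := Y i i - Y j j) (q' := Y i j) (r' := Y j i) (by linear_combination eij)
    (by linear_combination -eji)
  ext k l
  by_cases hkl : (k = i ∨ k = j) ∧ (l = i ∨ l = j)
  · rw [inn (mem hX) (mem hY) k l hkl.1 hkl.2, inn (mem hY) (mem hX) k l hkl.1 hkl.2]
    have u0 := blockWeight_ne_zero i j X
    have v0 := blockWeight_ne_zero i j Y
    rcases hw with ⟨h1, h2, h3⟩ | ⟨h1, h2, h3⟩ | hw
    · have h1 := sub_eq_zero.1 h1
      rcases hkl with ⟨rfl | rfl, rfl | rfl⟩ <;>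
        simp only [rescale_diag hij, rescale_apply_left, rescale_apply_right hij, h1, h2, h3] <;>
        ring
    · have h1 := sub_eq_zero.1 h1
      rcases hkl with ⟨rfl | rfl, rfl | rfl⟩ <;>
        simp only [rescale_diag hij, rescale_apply_left, rescale_apply_right hij, h1, h2, h3] <;>
        ring
    · have hw : blockWeight i j X = blockWeight i j Y := hw
      set v : ℂ := (blockWeight i j Y : ℂ) with hv
      have hvv := mul_inv_cancel₀ v0
      rcases hkl with ⟨rfl | rfl, rfl | rfl⟩ <;>
        simp only [rescale_diag hij, rescale_apply_left, rescale_apply_right hij, hw, ← hv]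
      · linear_combination v * v⁻¹ * eii
      · linear_combination v * eij
      · linear_combination v⁻¹ * eji
      · linear_combination -v * v⁻¹ * eii
  · rw [out hX hY k l hkl, out hY hX k l hkl, hXY]

/-- If `ρ j i` also holds, rescaling is conjugation by a diagonal matrix depending on `X`. Otherwise
`X` is block triangular for the index set `{k | ρ k i}`, and only an entry outside the diagonal
blocks changes. -/
lemma spectrum_rescale {i j : Fin n} (hij : i ≠ j) (h : ρ i j)
    (hcom : ∀ k, k ≠ i → k ≠ j → ¬ ((ρ i k ∨ ρ k i) ∧ (ρ j k ∨ ρ k j)))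
    {X : Matrix (Fin n) (Fin n) ℂ} (hX : X ∈ structuralMatrixAlgebra ρ hρ) :
    spectrum ℂ (rescale i j X) = spectrum ℂ X := by
  classical
  by_cases hji : ρ j i
  · set u : ℂ := (blockWeight i j X : ℂ) with hu
    have u0 : u ≠ 0 := blockWeight_ne_zero i j X
    have hinv : (fun k => (if k = i then u else 1) * (if k = i then u⁻¹ else 1)) = fun _ => 1 := by
      ext k
      split_ifs <;> simp [u0]
    let D : (Matrix (Fin n) (Fin n) ℂ)ˣ :=
      ⟨diagonal fun k => if k = i then u else 1, diagonal fun k => if k = i then u⁻¹ else 1,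
        by rw [diagonal_mul_diagonal, hinv, diagonal_one],
        by simp only [diagonal_mul_diagonal, mul_comm, hinv, diagonal_one]⟩
    have hD : rescale i j X = D.val * X * D⁻¹.val := by
      ext k l
      change _ = (diagonal (fun k => if k = i then u else 1) * X *
        diagonal fun k => if k = i then u⁻¹ else 1) k l
      rw [mul_diagonal, diagonal_mul]
      by_cases hl : k = i ∧ l = j
      · rw [hl.1, hl.2, rescale_apply_left]
        simp [hij.symm, hu]
      by_cases hr : k = j ∧ l = i
      · rw [hr.1, hr.2, rescale_apply_right hij]
        simp [hij.symm, hu, mul_comm]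
      rw [rescale_apply_of_not X hl hr]
      by_cases h0 : X k l = 0
      · simp [h0]
      have hkl := hX k l h0
      by_cases hk : k = i
      · subst hk
        by_cases hlk : l = k
        · subst hlk; simp only [if_true]; field_simp
        · have := hρ.trans j k l hji hkl
          have := hcom l
          tauto
      · by_cases hli : l = i
        · subst hli
          have := hρ.trans k l j hkl h
          have := hcom k
          tauto
        · simp [hk, hli]
    rw [hD, spectrum.units_conjugate]
  · ext c
    have hdet : (algebraMap ℂ (Matrix (Fin n) (Fin n) ℂ) c - rescale i j X).det =
        (algebraMap ℂ (Matrix (Fin n) (Fin n) ℂ) c - X).det := by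
      have tri : ∀ k, ¬ ρ k i → ∀ l, ρ l i → k ≠ l ∧ X k l = 0 := by
        intro k hk l hl
        refine ⟨fun h' => hk (h' ▸ hl), ?_⟩
        by_contra h0
        exact hk (hρ.trans k l i (hX k l h0) hl)
      have same : ∀ k l, (ρ k i ↔ ρ l i) → rescale i j X k l = X k l := by
        intro k l hkl
        have := hρ.refl i
        refine rescale_apply_of_not X ?_ ?_ <;> rintro ⟨rfl, rfl⟩ <;> tauto
      rw [twoBlockTriangular_det _ (fun k => ρ k i), twoBlockTriangular_det _ (fun k => ρ k i)]
      · congr 2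
        · ext k l
          simp only [toSquareBlockProp_def, of_apply, Matrix.sub_apply]
          rw [same _ _ (by simp [k.2, l.2])]
        · ext k l
          simp only [toSquareBlockProp_def, of_apply, Matrix.sub_apply]
          rw [same _ _ (by simp [k.2, l.2])]
      · intro k hk l hl
        obtain ⟨h1, h2⟩ := tri k hk l hl
        simp [Matrix.algebraMap_matrix_apply, h1, h2]
      · intro k hk l hl
        obtain ⟨h1, h2⟩ := tri k hk l hl
        simp [Matrix.algebraMap_matrix_apply, h1, rescale_apply_eq_zero i j h2]
    rw [spectrum.mem_iff, spectrum.mem_iff, isUnit_iff_isUnit_det, isUnit_iff_isUnit_det, hdet]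

lemma exists_nonlinear_preserver (hρ : IsQuasiOrder ρ) (h3 : ¬ ThreeCommonNeighbours ρ) :
    ∃ φ : structuralMatrixAlgebra ρ hρ → Matrix (Fin n) (Fin n) ℂ,
      IsPreserver φ ∧ ¬ IsLinearMap ℂ φ := by
  unfold ThreeCommonNeighbours at h3
  push Not at h3
  obtain ⟨i, j, h, hij, hcard⟩ := h3
  have hcom : ∀ k, k ≠ i → k ≠ j → ¬ ((ρ i k ∨ ρ k i) ∧ (ρ j k ∨ ρ k j)) := by
    intro k hki hkj hk
    have hsub : ({i, j, k} : Set (Fin n)) ⊆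
        (image ρ i ∪ preimage ρ i) ∩ (image ρ j ∪ preimage ρ j) := by
      have h1 := hρ.refl i
      have h2 := hρ.refl j
      rintro m (rfl | rfl | rfl)
      · exact ⟨Or.inl h1, Or.inr h⟩
      · exact ⟨Or.inl h, Or.inl h2⟩
      · exact hk
    have h1 := Set.ncard_le_ncard hsub
    rw [Set.ncard_eq_three.2 ⟨i, j, k, hij, hki.symm, hkj.symm, rfl⟩] at h1
    omega
  refine ⟨fun X => rescale i j X, ⟨?_, ?_, ?_, ?_⟩, ?_⟩
  · exact (rescale_injective hij).comp Subtype.val_injective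
  · exact (continuous_rescale hij).comp continuous_subtype_val
  · exact fun X Y hXY => commute_rescale hij h hcom X.2 Y.2 (congrArg Subtype.val hXY)
  · exact fun X => spectrum_rescale hij h hcom X.2
  · intro hlin
    -- The `{i, j}` block of `E_ii + E_ij` has weight `3 / 2`, while that of `E_ij` has weight `1`;
    -- additivity fails at `(i, j)`.
    have h1 := hlin.map_add ⟨single i i 1, single_mem (hρ.refl i) 1⟩ ⟨single i j 1, single_mem h 1⟩
    have h2 := congrFun (congrFun h1 i) j
    simp only [Matrix.add_apply, rescale_apply_left, AddMemClass.mk_add_mk, blockWeight,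
      weight] at h2
    simp [hij, hij.symm] at h2

end Nonlinear

end SMA

theorem mainTheorem1 (n : ℕ) (ρ : Fin n → Fin n → Prop) (hρ : SMA.IsQuasiOrder ρ) :
    (SMA.ThreeCommonNeighbours ρ ↔
      ∀ φ : SMA.structuralMatrixAlgebra ρ hρ → Matrix (Fin n) (Fin n) ℂ,
        SMA.IsPreserver φ → SMA.IsJordanEmbedding φ) ∧
    (SMA.ThreeCommonNeighbours ρ →
      ∀ φ : SMA.structuralMatrixAlgebra ρ hρ → Matrix (Fin n) (Fin n) ℂ,
        SMA.IsPreserver φ →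
          ∃ (S : (Matrix (Fin n) (Fin n) ℂ)ˣ) (g : Fin n → Fin n → ℂˣ)
            (hg : SMA.IsTransitiveMap ρ g) (P : SMA.structuralMatrixAlgebra ρ hρ),
            IsIdempotentElem P ∧ P ∈ Subalgebra.center ℂ (SMA.structuralMatrixAlgebra ρ hρ) ∧
            ∀ X : SMA.structuralMatrixAlgebra ρ hρ,
              φ X = S.val *
                ((P : Matrix (Fin n) (Fin n) ℂ) * (SMA.inducedAut hρ hg X).val +
                  (1 - (P : Matrix (Fin n) (Fin n) ℂ)) *
                    (SMA.inducedAut hρ hg X).val.transpose) * S⁻¹.val) ∧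
    (¬ SMA.ThreeCommonNeighbours ρ →
      ∃ φ : SMA.structuralMatrixAlgebra ρ hρ → Matrix (Fin n) (Fin n) ℂ,
        SMA.IsPreserver φ ∧ ¬ IsLinearMap ℂ φ) := by
  refine ⟨⟨fun h3 φ hφ => ?_, fun hJ => ?_⟩, fun h3 φ hφ => ?_, SMA.exists_nonlinear_preserver hρ⟩
  · obtain ⟨S, g, hg, p, hp, hp', hrep⟩ := hφ.exists_representation h3
    exact SMA.isJordanEmbedding_of_representation hφ.injective S hg hp hp' hrep
  · by_contra h3
    obtain ⟨φ, hφ, hlin⟩ := SMA.exists_nonlinear_preserver hρ h3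
    exact hlin (hJ φ hφ).linear
  · obtain ⟨S, g, hg, p, hp, hp', hrep⟩ := hφ.exists_representation h3
    exact ⟨S, g, hg, ⟨Matrix.diagonal p, SMA.diagonal_mem hρ p⟩,
      Subtype.ext (SMA.isIdempotentElem_diagonal hp).eq, SMA.diagonal_mem_center hp', hrep⟩
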